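/- Let $B$ be the bi-invariant metric on $SU(3)$ given by the negative of the Killing form, and let $I$ be a left-invariant (integrable) complex structure on $SU(3)$ that is orthogonal for $B$. Then there is a maximal torus of $SU(3)$, with Lie algebra $\mathfrak t$, and a choice of positive roots $\alpha,\beta,\alpha+\beta$, with $\alpha,\beta$ simple, such that the complex-linear extension of $I$ satisfies $I(E_\gamma)=iE_\gamma$ for every root vector $E_\gamma$ of a positive root $\gamma$. For every such torus and choice of positive roots the following holds. For $\lambda_\alpha,\lambda_\beta,\lambda_{\alpha+\beta}>0$ let $\Lambda$ be the operator on $\mathfrak{su}(3)$ that is the identity on $\mathfrak t$ and whose complex-linear extension is multiplication by $\lambda_\gamma$ on the root spaces of $\pm\gamma$, for $\gamma\in\{\alpha,\beta,\alpha+\beta\}$. Then $g=B(\Lambda\cdot,\cdot)$ is a left-invariant Riemannian metric, Hermitian for $I$ and invariant under right translations by the torus, and $(g,I)$ is CYT, i.e. the Ricci form $\rho^B(X,Y)=\sum_i g(R(X,Y)E_i,IE_i)$ ($E_i$ a $g$-orthonormal frame) of its Bismut connection (the connection that preserves $g$ and $I$ and has totally skew-symmetric torsion) vanishes, if and only if $$\frac1{\lambda_\alpha}+\frac1{\lambda_{\alpha+\beta}}=\frac1{\lambda_\beta}+\frac1{\lambda_{\alpha+\beta}}=2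 .$$ Consequently the invariant CYT metrics of the form $B(\Lambda\cdot,\cdot)$ form a one-parameter family, parametrized bijectively by $t\in(0,2)$ through $\lambda_\alpha=\lambda_\beta=1/t$, $\lambda_{\alpha+\beta}=1/(2-t)$. -/

import Mathlib

open scoped ContDiff Matrix

attribute [local instance] Matrix.linftyOpNormedAddCommGroup Matrix.linftyOpNormedSpace

noncomputable section

namespace SU3Geometry

/-- Complex `3 × 3` matrices. -/
abbrev Mat3 : Type := Matrix (Fin 3) (Fin 3) ℂ

/-- The group `SU(3)`. -/
abbrev SU3 : Type := Matrix.specialUnitaryGroup (Fin 3) ℂ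

/-- The real Lie algebra `𝔰𝔲(3)` of traceless skew-Hermitian matrices, the tangent space of
`SU(3)` at the identity. The tangent space at `p` is `p · 𝔰𝔲(3)`. -/
def su3 : Submodule ℝ Mat3 where
  carrier := {A | Aᴴ = -A ∧ A.trace = 0}
  add_mem' := by
    rintro A B ⟨hA, hA'⟩ ⟨hB, hB'⟩
    refine ⟨?_, ?_⟩
    · rw [Matrix.conjTranspose_add, hA, hB, neg_add]
    · rw [Matrix.trace_add, hA', hB', add_zero]
  zero_mem' := by simp
  smul_mem' := by
    rintro c A ⟨hA, hA'⟩
    refine ⟨?_, ?_⟩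
    · rw [Matrix.conjTranspose_smul, hA, star_trivial, smul_neg]
    · rw [Matrix.trace_smul, hA', smul_zero]

/-- The commutator on `𝔰𝔲(3)`. -/
def bracket (A B : su3) : su3 :=
  ⟨(A : Mat3) * B - B * A, by
    obtain ⟨A, hA, hA'⟩ := A
    obtain ⟨B, hB, hB'⟩ := B
    refine ⟨?_, ?_⟩
    · simp only [Matrix.conjTranspose_sub, Matrix.conjTranspose_mul, hA, hB]
      simp
    · simp only [Matrix.trace_sub]
      rw [Matrix.trace_mul_comm, sub_self]⟩

theorem exp_mem (A : su3) : NormedSpace.exp (A : Mat3) ∈ Matrix.specialUnitaryGroup (Fin 3) ℂ := by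
  obtain ⟨A, hA, hA'⟩ := A
  rw [Matrix.mem_specialUnitaryGroup_iff]
  refine ⟨?_, ?_⟩
  · rw [Matrix.mem_unitaryGroup_iff, Matrix.star_eq_conjTranspose, ← Matrix.exp_conjTranspose]
    simp only [hA, Matrix.exp_neg]
    exact Matrix.mul_nonsing_inv _
      ((Matrix.isUnit_iff_isUnit_det _).1 (Matrix.isUnit_exp A))
  · have hH : (Complex.I • A).IsHermitian := by
      rw [Matrix.IsHermitian, Matrix.conjTranspose_smul, hA]
      simp
    have hs := hH.spectral_theorem
    rw [Unitary.conjStarAlgAut_apply] at hs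
    have hu : IsUnit (hH.eigenvectorUnitary : Mat3) :=
      ⟨Unitary.toUnits hH.eigenvectorUnitary, rfl⟩
    have hinv : star (hH.eigenvectorUnitary : Mat3) = (hH.eigenvectorUnitary : Mat3)⁻¹ :=
      (Matrix.inv_eq_right_inv (Unitary.coe_mul_star_self _)).symm
    have hA2 : A = (hH.eigenvectorUnitary : Mat3) *
        Matrix.diagonal (fun i => -Complex.I * (hH.eigenvalues i : ℂ)) *
        (hH.eigenvectorUnitary : Mat3)⁻¹ := by
      have h1 : A = (-Complex.I) • (Complex.I • A) := by
        rw [smul_smul]; simp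
      refine h1.trans ?_
      conv_lhs => rw [hs]
      rw [hinv, ← smul_mul_assoc, ← mul_smul_comm, ← Matrix.diagonal_smul]
      rfl
    have htr : ∑ i, (hH.eigenvalues i : ℂ) = 0 := by
      have := hH.trace_eq_sum_eigenvalues
      rw [Matrix.trace_smul, hA', smul_zero] at this
      exact this.symm
    change (NormedSpace.exp A).det = 1
    rw [hA2, Matrix.exp_conj _ _ hu, Matrix.det_conj hu, Matrix.exp_diagonal, Matrix.det_diagonal]
    have : ∀ i, NormedSpace.exp (fun i => -Complex.I * (hH.eigenvalues i : ℂ)) i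
        = Complex.exp (-Complex.I * (hH.eigenvalues i : ℂ)) := by
      intro i
      rw [Pi.coe_exp, Complex.exp_eq_exp_ℂ]
    simp only [this]
    rw [← Complex.exp_sum, ← Finset.mul_sum, htr]
    simp

/-- The exponential map `𝔰𝔲(3) → SU(3)`. -/
def expSU3 (A : su3) : SU3 := ⟨NormedSpace.exp (A : Mat3), exp_mem A⟩

/-- The adjoint action `X ↦ V X V⁻¹` of `SU(3)` on `𝔰𝔲(3)`. -/
def Ad (V : SU3) (X : su3) : su3 :=
  ⟨(V : Mat3) * X * (V : Mat3)ᴴ, by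
    obtain ⟨X, hX, hX'⟩ := X
    have hV : (V : Mat3)ᴴ * (V : Mat3) = 1 :=
      Matrix.mem_unitaryGroup_iff'.1 (Matrix.mem_specialUnitaryGroup_iff.1 V.2).1
    refine ⟨?_, ?_⟩
    · simp [Matrix.conjTranspose_mul, hX, Matrix.mul_assoc]
    · rw [Matrix.trace_mul_comm, ← Matrix.mul_assoc, hV, Matrix.one_mul, hX']⟩

/-! ### Calculus on the group

`SU(3)` is a closed embedded submanifold of the space of matrices, so a function on it is smooth
exactly when it is the restriction of a smooth function of matrices. The tangent bundle is
trivialized by left translations: a function `X : SU3 → su3` stands for the vector field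
`p ↦ p · X p`, and constant functions stand for the left-invariant fields. -/

section Calculus

variable {V : Type*} [NormedAddCommGroup V] [NormedSpace ℝ V]

/-- Smooth functions on `SU(3)`. -/
def IsSmooth (f : SU3 → V) : Prop :=
  ∃ F : Mat3 → V, ContDiff ℝ ∞ F ∧ ∀ p : SU3, F (p : Mat3) = f p

/-- The derivative `(X f)(p) = d/dt f(p exp(t X(p)))` at `t = 0` of a function `f` along the
vector field `X`. -/
def fieldDeriv (X : SU3 → su3) (f : SU3 → V) (p : SU3) : V :=
  deriv (fun t : ℝ => f (p * expSU3 (t • X p))) 0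

end Calculus

/-- The Lie bracket of vector fields, in the left trivialization. -/
def fieldBracket (X Y : SU3 → su3) (p : SU3) : su3 :=
  fieldDeriv X Y p - fieldDeriv Y X p + bracket (X p) (Y p)

/-- Affine connections on `SU(3)`; `D X Y` is the covariant derivative of `Y` along `X`
(only its values on smooth fields matter). -/
structure IsConnection (D : (SU3 → su3) → (SU3 → su3) → SU3 → su3) : Prop where
  smooth : ∀ X Y, IsSmooth X → IsSmooth Y → IsSmooth (D X Y)
  add_left : ∀ X X' Y, IsSmooth X → IsSmooth X' → IsSmooth Y →
    D (X + X') Y = D X Y + D X' Y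
  smul_left : ∀ (f : SU3 → ℝ) (X Y), IsSmooth f → IsSmooth X → IsSmooth Y →
    D (fun p => f p • X p) Y = fun p => f p • D X Y p
  add_right : ∀ X Y Y', IsSmooth X → IsSmooth Y → IsSmooth Y' →
    D X (Y + Y') = D X Y + D X Y'
  leibniz : ∀ (f : SU3 → ℝ) (X Y), IsSmooth f → IsSmooth X → IsSmooth Y →
    D X (fun p => f p • Y p) = fun p => fieldDeriv X f p • Y p + f p • D X Y p

/-- The torsion of a connection. -/
def torsion (D : (SU3 → su3) → (SU3 → su3) → SU3 → su3) (X Y : SU3 → su3) (p : SU3) : su3 :=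
  D X Y p - D Y X p - fieldBracket X Y p

/-- The curvature `R(X,Y)Z` of a connection. -/
def curvature (D : (SU3 → su3) → (SU3 → su3) → SU3 → su3) (X Y Z : SU3 → su3) (p : SU3) : su3 :=
  D X (D Y Z) p - D Y (D X Z) p - D (fieldBracket X Y) Z p

/-! ### Left-invariant structures

A left-invariant tensor field is constant in the left trivialization, hence is given by a tensor
on `𝔰𝔲(3)`. -/

/-- The left-invariant endomorphism field `J` is an integrable complex structure: `J² = -1` and
its Nijenhuis tensor vanishes. -/
structure IsInvariantComplexStructure (J : su3 →ₗ[ℝ] su3) : Prop where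
  sq_eq_neg : ∀ X, J (J X) = -X
  nijenhuis : ∀ X Y : SU3 → su3, IsSmooth X → IsSmooth Y → ∀ p,
    fieldBracket (fun q => J (X q)) (fun q => J (Y q)) p
      - J (fieldBracket (fun q => J (X q)) Y p) - J (fieldBracket X (fun q => J (Y q)) p)
      - fieldBracket X Y p = 0

/-- The left-invariant tensor field `g` is a Riemannian metric that is Hermitian for `J`. -/
structure IsInvariantHermitianMetric (J : su3 →ₗ[ℝ] su3) (g : su3 →ₗ[ℝ] su3 →ₗ[ℝ] ℝ) : Prop where
  symm : ∀ X Y, g X Y = g Y X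
  pos : ∀ X, X ≠ 0 → 0 < g X X
  hermitian : ∀ X Y, g (J X) (J Y) = g X Y

/-- `D` is the Bismut (KT) connection of `(g, J)`: it preserves `g` and `J` and its torsion is
totally skew-symmetric. -/
structure IsBismutConnection (J : su3 →ₗ[ℝ] su3) (g : su3 →ₗ[ℝ] su3 →ₗ[ℝ] ℝ)
    (D : (SU3 → su3) → (SU3 → su3) → SU3 → su3) : Prop extends IsConnection D where
  metric : ∀ X Y Z, IsSmooth X → IsSmooth Y → IsSmooth Z → ∀ p,
    fieldDeriv X (fun q => g (Y q) (Z q)) p = g (D X Y p) (Z p) + g (Y p) (D X Z p)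
  complex : ∀ X Y, IsSmooth X → IsSmooth Y → ∀ p, D X (fun q => J (Y q)) p = J (D X Y p)
  skew : ∀ X Y Z, IsSmooth X → IsSmooth Y → IsSmooth Z → ∀ p,
    g (torsion D X Y p) (Z p) = -g (torsion D X Z p) (Y p)

/-- The Ricci form `ρ(X,Y) = ∑ᵢ g(R(X,Y)Eᵢ, J Eᵢ)` of a connection, where `E` is a frame of
left-invariant fields (to be taken `g`-orthonormal). -/
def ricciForm {ι : Type*} [Fintype ι] (J : su3 →ₗ[ℝ] su3) (g : su3 →ₗ[ℝ] su3 →ₗ[ℝ] ℝ)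
    (D : (SU3 → su3) → (SU3 → su3) → SU3 → su3) (E : ι → su3) (X Y : SU3 → su3) (p : SU3) : ℝ :=
  ∑ i, g (curvature D X Y (fun _ => E i) p) (J (E i))

/-- `(g, J)` is Calabi-Yau with torsion: the Ricci form of the Bismut connection vanishes. -/
def IsCYT (J : su3 →ₗ[ℝ] su3) (g : su3 →ₗ[ℝ] su3 →ₗ[ℝ] ℝ) : Prop :=
  ∃ D, IsBismutConnection J g D ∧
    ∀ E : Module.Basis (Fin (Module.finrank ℝ su3)) ℝ su3,
      (∀ i j, g (E i) (E j) = if i = j then 1 else 0) →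
      ∀ X Y, IsSmooth X → IsSmooth Y → ∀ p, ricciForm J g D E X Y p = 0

/-! ### Deformations of the bi-invariant metric -/

/-- The bi-invariant metric `B`, the negative `-6 tr(XY)` of the Killing form. -/
def B : su3 →ₗ[ℝ] su3 →ₗ[ℝ] ℝ :=
  LinearMap.mk₂ ℝ (fun X Y => -6 * ((X : Mat3) * (Y : Mat3)).trace.re)
    (by intro X X' Y; simp [Matrix.add_mul]; ring)
    (by intro c X Y; simp; ring)
    (by intro X Y Y'; simp [Matrix.mul_add]; ring)
    (by intro c X Y; simp; ring)

/-- A unitary frame `U` determines the maximal torus of the matrices that are diagonal in this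
frame, the root vectors `U E_{jk} U⁻¹` and the positive roots `j < k`. It is adapted to `J` if the
complex-linear extension of `J` acts as multiplication by `i` on all positive root vectors. Here
`X + iY` with `X Y : su3` is the decomposition of `U E_{jk} U⁻¹` in the complexification
`𝔰𝔩(3, ℂ)` of `𝔰𝔲(3)`, which exists and is unique. -/
def IsAdapted (J : su3 →ₗ[ℝ] su3) (U : SU3) : Prop :=
  ∀ j k : Fin 3, j < k → ∃ X Y : su3,
    (X : Mat3) + Complex.I • (Y : Mat3) = (U : Mat3) * Matrix.single j k 1 * (U : Mat3)ᴴ ∧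
    ((J X : su3) : Mat3) + Complex.I • ((J Y : su3) : Mat3)
      = Complex.I • ((X : Mat3) + Complex.I • (Y : Mat3))

/-- The matrix of eigenvalues of `Λ`: `1` on the Cartan subalgebra, `a` on the root spaces
`±α`, where `α = e₁ - e₂`, `b` on those of `±β`, where `β = e₂ - e₃`, and `c` on those of
`±(α + β)`. -/
def weights (a b c : ℝ) : Mat3 := !![1, (a : ℂ), (c : ℂ); (a : ℂ), 1, (b : ℂ); (c : ℂ), (b : ℂ), 1]

theorem Lam_mem (U : SU3) (a b c : ℝ) (X : su3) :
    (U : Mat3) * (weights a b c ⊙ ((U : Mat3)ᴴ * X * (U : Mat3))) * (U : Mat3)ᴴ ∈ su3 := by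
  obtain ⟨X, hX, hX'⟩ := X
  have hU : (U : Mat3)ᴴ * (U : Mat3) = 1 :=
    Matrix.mem_unitaryGroup_iff'.1 (Matrix.mem_specialUnitaryGroup_iff.1 U.2).1
  have hU' : (U : Mat3) * (U : Mat3)ᴴ = 1 :=
    Matrix.mem_unitaryGroup_iff.1 (Matrix.mem_specialUnitaryGroup_iff.1 U.2).1
  have hY : ((U : Mat3)ᴴ * X * (U : Mat3))ᴴ = -((U : Mat3)ᴴ * X * (U : Mat3)) := by
    simp [Matrix.conjTranspose_mul, hX, Matrix.mul_assoc]
  have hW : (weights a b c ⊙ ((U : Mat3)ᴴ * X * (U : Mat3)))ᴴ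
      = -(weights a b c ⊙ ((U : Mat3)ᴴ * X * (U : Mat3))) := by
    ext i j
    have h := congrFun (congrFun hY i) j
    rw [Matrix.conjTranspose_apply, Matrix.neg_apply] at h
    rw [Matrix.conjTranspose_apply, Matrix.neg_apply, Matrix.hadamard_apply,
      Matrix.hadamard_apply, star_mul', h]
    fin_cases i <;> fin_cases j <;> simp [weights]
  refine ⟨?_, ?_⟩
  · rw [Matrix.conjTranspose_mul, Matrix.conjTranspose_mul, hW]
    simp [Matrix.mul_assoc]
  · rw [Matrix.trace_mul_comm, ← Matrix.mul_assoc, hU, Matrix.one_mul]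
    have h1 : (weights a b c ⊙ ((U : Mat3)ᴴ * X * (U : Mat3))).trace
        = ((U : Mat3)ᴴ * X * (U : Mat3)).trace := by
      simp [Matrix.trace, Fin.sum_univ_three, weights]
    rw [h1, Matrix.trace_mul_comm, ← Matrix.mul_assoc, hU', Matrix.one_mul]
    exact hX'

/-- The operator `Λ`: the identity on the Cartan subalgebra of the frame `U`, and multiplication
by `λ_α = a`, `λ_β = b`, `λ_{α+β} = c` on the root spaces. -/
def Lam (U : SU3) (a b c : ℝ) : su3 →ₗ[ℝ] su3 where
  toFun X := ⟨(U : Mat3) * (weights a b c ⊙ ((U : Mat3)ᴴ * X * (U : Mat3))) * (U : Mat3)ᴴ,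
    Lam_mem U a b c X⟩
  map_add' X Y := by
    apply Subtype.ext
    simp [Matrix.mul_add, Matrix.add_mul, Matrix.hadamard_add]
  map_smul' r X := by
    apply Subtype.ext
    simp [Matrix.hadamard_smul]

/-- The metric `B(Λ·,·)`. -/
def metric (U : SU3) (a b c : ℝ) : su3 →ₗ[ℝ] su3 →ₗ[ℝ] ℝ := B ∘ₗ Lam U a b c

/-- The left-invariant metric `g` is also invariant under right translations by the maximal torus
of the frame `U`. -/
def IsTorusInvariant (U : SU3) (g : su3 →ₗ[ℝ] su3 →ₗ[ℝ] ℝ) : Prop :=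
  ∀ V : SU3, ((U : Mat3)ᴴ * (V : Mat3) * (U : Mat3)).IsDiag →
    ∀ X Y, g (Ad V X) (Ad V Y) = g X Y

end SU3Geometry

end

/-!
Since `J` is integrable, its `i`-eigenspace in `𝔰𝔩(3, ℂ)` is a complex subalgebra; since `J` is
orthogonal, the trace form vanishes on it. By Cartan's criterion it is solvable, so by Lie's theorem
it is upper triangular in some unitary frame, and that frame carries the adapted torus.

A left-invariant Hermitian metric on a Lie group has exactly one Bismut product `Γ`, given by a
Koszul formula plus a torsion term, and its Ricci form is `(X, Y) ↦ tr (J Γ [X, Y])`.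
For `B` itself `Γ` vanishes, so in a basis `e, J e` orthogonal for both `g` and `B` only the
difference `2 ∑ (g([e, Je], X) / g(e, e) - B([e, Je], X) / B(e, e))` of two sums survives. For
root vectors `e` this is `2 ∑ (λ_γ⁻¹ - 1) γ(X)`, whose vanishing on the commutator subalgebra is the
stated pair of equations.
-/

/-! ### Lie algebras with vanishing trace form -/

section LieTheory

attribute [local instance] LieRing.ofAssociativeRing

theorem isSolvable_of_trace_mul_eq_zero {k V : Type*} [Field k] [CharZero k] [AddCommGroup V]
    [Module k V] [FiniteDimensional k V] (L : LieSubalgebra k (Module.End k V))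
    (h : ∀ f ∈ L, ∀ g ∈ L, LinearMap.trace k V (f * g) = 0) : LieAlgebra.IsSolvable L := by
  have trace_form : LieModule.traceForm k L V = 0 := by
    ext ⟨f, hf⟩ ⟨g, hg⟩
    exact h f hf g hg
  have module_nilpotent : LieModule.IsNilpotent (LieAlgebra.derivedSeries k L 1) V :=
    LieModule.isNilpotent_derivedSeries_of_traceForm_eq_zero trace_form
  have ring_nilpotent : LieRing.IsNilpotent (LieAlgebra.derivedSeries k L 1) := by
    rw [LieAlgebra.isNilpotent_iff_forall (R := k)]
    intro f
    apply LieSubalgebra.isNilpotent_ad_of_isNilpotent_ad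
      (LieAlgebra.derivedSeries k L 1 : LieSubalgebra k L)
    apply LieAlgebra.isNilpotent_ad_of_isNilpotent
    exact (LieModule.isNilpotent_iff_forall' (R := k)).mp module_nilpotent f
  obtain ⟨m, hm⟩ := LieAlgebra.IsSolvable.solvable k (LieAlgebra.derivedSeries k L 1)
  rw [LieIdeal.derivedSeries_eq_bot_iff] at hm
  refine LieAlgebra.IsSolvable.mk (k := m + 1) (R := k) ?_
  rwa [LieAlgebra.derivedSeries_def, LieAlgebra.derivedSeriesOfIdeal_add]

theorem exists_lieSubmodule_finrank_add_one_eq (k L V : Type*) [Field k] [CharZero k]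
    [IsAlgClosed k] [LieRing L] [LieAlgebra k L] [LieAlgebra.IsSolvable L] [AddCommGroup V]
    [Module k V] [FiniteDimensional k V] [Nontrivial V] [LieRingModule L V] [LieModule k L V] :
    ∃ P : LieSubmodule k L V, Module.finrank k P + 1 = Module.finrank k V := by
  obtain ⟨χ, hχ⟩ := LieModule.exists_nontrivial_weightSpace_of_isSolvable k L (Module.Dual k V)
  obtain ⟨⟨φ, hφ⟩, hφ₀⟩ := exists_ne (0 : LieModule.weightSpace (Module.Dual k V) χ)
  rw [LieModule.mem_weightSpace] at hφ
  have apply_lie (x : L) (v : V) : φ ⁅x, v⁆ = -(χ x * φ v) := by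
    rw [eq_neg_iff_add_eq_zero, ← smul_eq_mul, ← LinearMap.smul_apply, ← hφ x,
      Module.Dual.lie_apply, add_neg_cancel]
  refine ⟨{ toSubmodule := LinearMap.ker φ, lie_mem := fun {x v} hv => ?_ },
    Module.Dual.finrank_ker_add_one_of_ne_zero fun h => hφ₀ (Subtype.ext h)⟩
  have hv : φ v = 0 := hv
  change φ ⁅x, v⁆ = 0
  rw [apply_lie, hv, mul_zero, neg_zero]

theorem exists_orthonormalBasis_inner_lie_eq_zero {L : Type*} [LieRing L] [LieAlgebra ℂ L]
    [LieAlgebra.IsSolvable L] {n : ℕ} {E : Type*} [NormedAddCommGroup E] [InnerProductSpace ℂ E]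
    [FiniteDimensional ℂ E] [LieRingModule L E] [LieModule ℂ L E]
    (hn : Module.finrank ℂ E = n) :
    ∃ b : OrthonormalBasis (Fin n) ℂ E, ∀ (x : L) (j k : Fin n), j < k →
      inner ℂ (b k) ⁅x, b j⁆ = 0 := by
  induction n generalizing E with
  | zero => exact ⟨(stdOrthonormalBasis ℂ E).reindex (finCongr hn), fun _ j => j.elim0⟩
  | succ n ih =>
    have : Nontrivial E := Module.nontrivial_of_finrank_pos (R := ℂ) (by omega)
    obtain ⟨P, hP⟩ := exists_lieSubmodule_finrank_add_one_eq ℂ L E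
    let _ : NormedAddCommGroup P := inferInstanceAs (NormedAddCommGroup P.toSubmodule)
    let _ : InnerProductSpace ℂ P := inferInstanceAs (InnerProductSpace ℂ P.toSubmodule)
    obtain ⟨b, hb⟩ := ih (E := P) (by omega)
    have b_orthonormal : Orthonormal ℂ fun i => (b i : E) :=
      b.orthonormal.comp_linearIsometry P.toSubmodule.subtypeₗᵢ
    obtain ⟨b', hb'⟩ := Orthonormal.exists_orthonormalBasis_extension_of_card_eq
      (v := Fin.snoc (fun i => (b i : E)) 0) (s := Set.range Fin.castSucc) (by simpa using hn) (by
        refine ⟨?_, ?_⟩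
        · rintro ⟨_, i, rfl⟩
          simpa using b_orthonormal.1 i
        · rintro ⟨_, i, rfl⟩ ⟨_, j, rfl⟩ hij
          simpa using b_orthonormal.2 fun h : i = j => hij (by rw [h]))
    have b'_castSucc (i : Fin n) : b' i.castSucc = b i := by simpa using hb' i.castSucc ⟨i, rfl⟩
    have inner_last (y : P) : inner ℂ (b' (Fin.last n)) (y : E) = 0 := by
      rw [← b.sum_repr y, AddSubmonoidClass.coe_finsetSum, inner_sum]
      refine Finset.sum_eq_zero fun i _ => ?_
      change inner ℂ _ (b.repr y i • (b i : E)) = 0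
      rw [inner_smul_right, ← b'_castSucc, b'.inner_eq_zero (Fin.castSucc_lt_last i).ne', mul_zero]
    refine ⟨b', fun x j k hjk => ?_⟩
    obtain ⟨j, rfl⟩ := Fin.exists_castSucc_eq.2 (Fin.ne_last_of_lt hjk)
    rw [b'_castSucc]
    induction k using Fin.lastCases with
    | last => exact inner_last ⁅x, b j⁆
    | cast k =>
      rw [b'_castSucc]
      exact hb x j k (by simpa using hjk)

theorem exists_unitary_blockTriangular {n : ℕ} (q : LieSubalgebra ℂ (Matrix (Fin n) (Fin n) ℂ))
    (hq : ∀ M ∈ q, ∀ N ∈ q, (M * N).trace = 0) :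
    ∃ U ∈ Matrix.unitaryGroup (Fin n) ℂ, ∀ M ∈ q, (Uᴴ * M * U).BlockTriangular id := by
  let e := EuclideanSpace.basisFun (Fin n) ℂ
  let Φ := LinearMap.toMatrixOrthonormal e
  let L : LieSubalgebra ℂ (Module.End ℂ (EuclideanSpace ℂ (Fin n))) :=
    q.comap (Φ.toAlgEquiv : _ →ₐ[ℂ] _).toLieHom
  have : LieAlgebra.IsSolvable L := isSolvable_of_trace_mul_eq_zero L fun f hf g hg => by
    rw [LinearMap.trace_eq_matrix_trace ℂ e.toBasis, LinearMap.toMatrix_mul]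
    exact hq _ hf _ hg
  obtain ⟨b, hb⟩ := exists_orthonormalBasis_inner_lie_eq_zero (L := L) (n := n)
    (finrank_euclideanSpace_fin (𝕜 := ℂ))
  refine ⟨e.toBasis.toMatrix b, e.toMatrix_orthonormalBasis_mem_unitary b, fun M hM k j hjk => ?_⟩
  have hM' : Φ (Φ.symm M) ∈ q := by rwa [Φ.apply_symm_apply]
  have conjTranspose_toMatrix : (e.toBasis.toMatrix b)ᴴ = b.toBasis.toMatrix e.toBasis := by
    ext
    simp [Module.Basis.toMatrix_apply, OrthonormalBasis.repr_apply_apply]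
  calc ((e.toBasis.toMatrix b)ᴴ * M * e.toBasis.toMatrix b) k j
    _ = (b.toBasis.toMatrix e.toBasis * Φ (Φ.symm M) * e.toBasis.toMatrix b.toBasis) k j := by
      rw [conjTranspose_toMatrix, Φ.apply_symm_apply, b.coe_toBasis]
    _ = LinearMap.toMatrixOrthonormal b (Φ.symm M) k j :=
      congrFun₂ (basis_toMatrix_mul_linearMap_toMatrix_mul_basis_toMatrix ..) k j
    _ = inner ℂ (b k) (Φ.symm M (b j)) := LinearMap.toMatrixOrthonormal_apply_apply ..
    _ = 0 := hb ⟨Φ.symm M, hM'⟩ j k hjk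

theorem exists_mul_diagonal_mem_specialUnitaryGroup {n : Type*} [Fintype n] [DecidableEq n]
    {U : Matrix n n ℂ} (hU : U ∈ Matrix.unitaryGroup n ℂ) :
    ∃ d : n → ℂ, U * Matrix.diagonal d ∈ Matrix.specialUnitaryGroup n ℂ := by
  have hdet : U.det ∈ unitary ℂ := Matrix.det_of_mem_unitary hU
  obtain h | ⟨⟨i⟩⟩ := isEmpty_or_nonempty n
  · exact ⟨1, by simp [Matrix.mem_specialUnitaryGroup_iff, hU]⟩
  refine ⟨Function.update 1 i (star U.det), Matrix.mem_specialUnitaryGroup_iff.2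
    ⟨mul_mem hU ?_, ?_⟩⟩
  · rw [Matrix.mem_unitaryGroup_iff', Matrix.star_eq_conjTranspose, Matrix.diagonal_conjTranspose,
      Matrix.diagonal_mul_diagonal, ← Matrix.diagonal_one]
    congr 1
    ext j
    obtain rfl | hj := eq_or_ne j i
    · simpa using hdet.2
    · simp [hj]
  · rw [Matrix.det_mul, Matrix.det_diagonal, Finset.prod_update_of_mem (Finset.mem_univ i)]
    simpa using hdet.2

theorem exists_specialUnitary_blockTriangular {n : ℕ}
    (q : LieSubalgebra ℂ (Matrix (Fin n) (Fin n) ℂ))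
    (hq : ∀ M ∈ q, ∀ N ∈ q, (M * N).trace = 0) :
    ∃ U ∈ Matrix.specialUnitaryGroup (Fin n) ℂ, ∀ M ∈ q, (Uᴴ * M * U).BlockTriangular id := by
  obtain ⟨U, hU, h⟩ := exists_unitary_blockTriangular q hq
  obtain ⟨d, hd⟩ := exists_mul_diagonal_mem_specialUnitaryGroup hU
  refine ⟨_, hd, fun M hM => ?_⟩
  rw [show (U * Matrix.diagonal d)ᴴ * M * (U * Matrix.diagonal d)
      = Matrix.diagonal (star d) * (Uᴴ * M * U) * Matrix.diagonal d by
    simp only [Matrix.conjTranspose_mul, Matrix.diagonal_conjTranspose, Matrix.mul_assoc]]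
  exact ((Matrix.blockTriangular_diagonal _).mul (h M hM)).mul (Matrix.blockTriangular_diagonal _)

end LieTheory

noncomputable section

/-! ### Bilinear forms -/

section BilinearForms

variable {K V ι : Type*} [Field K] [AddCommGroup V] [Module K V]

theorem trace_eq_sum_of_isOrthoᵢ [Fintype ι] {g : V →ₗ[K] V →ₗ[K] K}
    {E : Module.Basis ι K V} (hE : g.IsOrthoᵢ E) (hE₀ : ∀ i, g (E i) (E i) ≠ 0)
    (f : Module.End K V) :
    LinearMap.trace K V f = ∑ i, g (f (E i)) (E i) / g (E i) (E i) := by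
  have repr_apply (v : V) (i : ι) : E.repr v i = g v (E i) / g (E i) (E i) := by
    have : g v (E i) = E.repr v i * g (E i) (E i) := by
      conv_lhs => rw [← E.sum_repr v, map_sum, LinearMap.sum_apply]
      rw [Finset.sum_eq_single i (fun j _ hj => ?_) (by simp), map_smul, LinearMap.smul_apply,
        smul_eq_mul]
      rw [map_smul, LinearMap.smul_apply, LinearMap.isOrthoᵢ_def.1 hE j i hj, smul_zero]
    rw [this, mul_div_cancel_right₀ _ (hE₀ i)]
  classical
  rw [LinearMap.trace_eq_matrix_trace K E, Matrix.trace]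
  simp only [Matrix.diag_apply, LinearMap.toMatrix_apply, repr_apply]

theorem exists_basis_eq_of_isOrthoᵢ [Finite ι] {g : V →ₗ[K] V →ₗ[K] K} {v : ι → V}
    (hv : g.IsOrthoᵢ v) (hv₀ : ∀ i, g (v i) (v i) ≠ 0)
    (hv_total : ∀ X, (∀ i, g X (v i) = 0) → X = 0) :
    ∃ E : Module.Basis ι K V, ⇑E = v := by
  classical
  have := Fintype.ofFinite ι
  have span_eq_top (X : V) : X = ∑ i, (g X (v i) / g (v i) (v i)) • v i := by
    refine sub_eq_zero.1 (hv_total _ fun j => ?_)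
    rw [map_sub, LinearMap.sub_apply, map_sum, LinearMap.sum_apply,
      Finset.sum_eq_single j (fun i _ hi => ?_) (by simp), map_smul, LinearMap.smul_apply,
      smul_eq_mul, div_mul_cancel₀ _ (hv₀ j), sub_self]
    rw [map_smul, LinearMap.smul_apply, LinearMap.isOrthoᵢ_def.1 hv i j hi, smul_zero]
  refine ⟨Module.Basis.mk (LinearMap.linearIndependent_of_isOrthoᵢ hv hv₀) fun X _ => ?_,
    Module.Basis.coe_mk ..⟩
  rw [span_eq_top X]
  exact Submodule.sum_mem _ fun i _ =>
    Submodule.smul_mem _ _ (Submodule.subset_span ⟨i, rfl⟩)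

theorem exists_bilinear_forall_apply_eq [FiniteDimensional K V] {g : LinearMap.BilinForm K V}
    (hg : g.Nondegenerate) (T : V →ₗ[K] V →ₗ[K] V →ₗ[K] K) :
    ∃ Γ : V →ₗ[K] V →ₗ[K] V, ∀ X Y Z, g (Γ X Y) Z = T X Y Z := by
  refine ⟨T.compr₂ (g.toDual hg).symm.toLinearMap, fun X Y Z => ?_⟩
  rw [LinearMap.compr₂_apply]
  exact LinearMap.BilinForm.apply_toDual_symm_apply ..

end BilinearForms

section PositiveDefinite

variable {V : Type*} [AddCommGroup V] [Module ℝ V] {g : V →ₗ[ℝ] V →ₗ[ℝ] ℝ}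

theorem eq_of_forall_apply_eq (hpos : ∀ X, X ≠ 0 → 0 < g X X) {X Y : V}
    (h : ∀ Z, g X Z = g Y Z) : X = Y := by
  by_contra hXY
  refine (hpos _ (sub_ne_zero.2 hXY)).ne' ?_
  rw [map_sub g, LinearMap.sub_apply, h, sub_self]

theorem nondegenerate_of_pos (hpos : ∀ X, X ≠ 0 → 0 < g X X) :
    LinearMap.BilinForm.Nondegenerate g := by
  refine ⟨fun X hX => ?_, fun X hX => ?_⟩ <;> by_contra h <;> exact (hpos X h).ne' (hX X)

theorem exists_basis_orthonormal [FiniteDimensional ℝ V] (hsymm : ∀ X Y, g X Y = g Y X)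
    (hpos : ∀ X, X ≠ 0 → 0 < g X X) :
    ∃ E : Module.Basis (Fin (Module.finrank ℝ V)) ℝ V,
      ∀ i j, g (E i) (E j) = if i = j then 1 else 0 := by
  have : Invertible (2 : ℝ) := invertibleOfNonzero two_ne_zero
  obtain ⟨v, hv⟩ := LinearMap.BilinForm.exists_orthogonal_basis (B := g) ⟨hsymm⟩
  have hsqrt (i) : 0 < √(g (v i) (v i)) := Real.sqrt_pos.2 (hpos _ (v.ne_zero i))
  refine ⟨v.unitsSMul fun i => Units.mk0 _ (inv_ne_zero (hsqrt i).ne'), fun i j => ?_⟩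
  simp only [Module.Basis.unitsSMul_apply, Units.smul_mk0, map_smul, LinearMap.smul_apply,
    smul_eq_mul]
  split_ifs with h
  · rw [← h, ← mul_assoc, ← mul_inv, Real.mul_self_sqrt (hpos _ (v.ne_zero i)).le,
      inv_mul_cancel₀ (hpos _ (v.ne_zero i)).ne']
  · rw [show g (v i) (v j) = 0 from hv h, mul_zero, mul_zero]

end PositiveDefinite

/-! ### Bismut connections of left-invariant structures -/

section Bismut

variable {𝔤 : Type*} [LieRing 𝔤] [LieAlgebra ℝ 𝔤]

/-- A left-invariant integrable complex structure on a Lie group with Lie algebra `𝔤`: an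
endomorphism with square `-1` whose Nijenhuis tensor vanishes. -/
structure IsComplexStructure (J : 𝔤 →ₗ[ℝ] 𝔤) : Prop where
  map_map : ∀ X, J (J X) = -X
  nijenhuis : ∀ X Y, ⁅J X, J Y⁆ - J ⁅J X, Y⁆ - J ⁅X, J Y⁆ - ⁅X, Y⁆ = 0

/-- A left-invariant Riemannian metric on a Lie group with Lie algebra `𝔤` that is Hermitian for
the almost complex structure `J`. -/
structure IsHermitianMetric (J : 𝔤 →ₗ[ℝ] 𝔤) (g : 𝔤 →ₗ[ℝ] 𝔤 →ₗ[ℝ] ℝ) : Prop where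
  symm : ∀ X Y, g X Y = g Y X
  pos : ∀ X, X ≠ 0 → 0 < g X X
  map_map : ∀ X Y, g (J X) (J Y) = g X Y

/-- The Bismut connection of the left-invariant structure `(g, J)` in the left trivialization,
where `Γ X Y` stands for the covariant derivative of the left-invariant field `Y` along `X`: it
preserves `g` and `J` and its torsion is totally skew-symmetric. -/
structure IsBismutProduct (J : 𝔤 →ₗ[ℝ] 𝔤) (g : 𝔤 →ₗ[ℝ] 𝔤 →ₗ[ℝ] ℝ) (Γ : 𝔤 → 𝔤 → 𝔤) : Prop where
  metric : ∀ X Y Z, g (Γ X Y) Z = -g Y (Γ X Z)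
  complex : ∀ X Y, Γ X (J Y) = J (Γ X Y)
  skew : ∀ X Y Z, g (Γ X Y - Γ Y X - ⁅X, Y⁆) Z = -g (Γ X Z - Γ Z X - ⁅X, Z⁆) Y

/-- The torsion 3-form `dω(JX, JY, JZ)` of the Bismut connection of `(g, J)`, where
`ω(X, Y) = g(JX, Y)` is the fundamental form. -/
def torsionForm (J : 𝔤 →ₗ[ℝ] 𝔤) (g : 𝔤 →ₗ[ℝ] 𝔤 →ₗ[ℝ] ℝ) (X Y Z : 𝔤) : ℝ :=
  -(g ⁅J X, J Y⁆ Z + g ⁅J Y, J Z⁆ X + g ⁅J Z, J X⁆ Y)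

/-- The Bismut connection of `(g, J)` as a trilinear form `g(∇_X Y, Z)`: the Koszul formula for
the Levi-Civita connection, plus half the torsion. -/
def bismutForm (J : 𝔤 →ₗ[ℝ] 𝔤) (g : 𝔤 →ₗ[ℝ] 𝔤 →ₗ[ℝ] ℝ) (X Y Z : 𝔤) : ℝ :=
  (g ⁅X, Y⁆ Z - g ⁅Y, Z⁆ X + g ⁅Z, X⁆ Y + torsionForm J g X Y Z) / 2

variable {J : 𝔤 →ₗ[ℝ] 𝔤} {g : 𝔤 →ₗ[ℝ] 𝔤 →ₗ[ℝ] ℝ}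

theorem IsHermitianMetric.apply_map_left (hg : IsHermitianMetric J g)
    (hJ : ∀ X, J (J X) = -X) (X Y : 𝔤) : g (J X) Y = -g X (J Y) := by
  rw [← hg.map_map (J X), hJ, map_neg g, LinearMap.neg_apply]

theorem IsHermitianMetric.apply_map_self (hJ : ∀ X, J (J X) = -X) (hg : IsHermitianMetric J g)
    (X : 𝔤) : g X (J X) = 0 := by
  linarith [hg.apply_map_left hJ X X, hg.symm (J X) X]

theorem IsHermitianMetric.isOrthoᵢ_sumElim_map {ι : Type*} {e : ι → 𝔤}
    (hJ : ∀ X, J (J X) = -X) (hg : IsHermitianMetric J g) (he : g.IsOrthoᵢ e)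
    (he_map : ∀ i j, g (J (e i)) (e j) = 0) :
    g.IsOrthoᵢ (Sum.elim e (J ∘ e)) := by
  have he_map' (i j) : g (e i) (J (e j)) = 0 := by
    rw [← neg_eq_zero, ← hg.apply_map_left hJ, he_map]
  rw [LinearMap.isOrthoᵢ_def] at he ⊢
  rintro (i | i) (j | j) hij
  · exact he i j (by simpa using hij)
  · exact he_map' i j
  · exact he_map i j
  · exact (hg.map_map _ _).trans (he i j (by simpa using hij))

theorem lie_apply_swap (X Y Z : 𝔤) : g ⁅X, Y⁆ Z = -g ⁅Y, X⁆ Z := by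
  rw [← lie_skew, map_neg, LinearMap.neg_apply]

theorem torsionForm_swap_left (X Y Z : 𝔤) : torsionForm J g X Y Z = -torsionForm J g Y X Z := by
  simp only [torsionForm]
  rw [lie_apply_swap (J X) (J Y), lie_apply_swap (J Y) (J Z), lie_apply_swap (J Z) (J X)]
  ring

theorem torsionForm_swap_right (X Y Z : 𝔤) : torsionForm J g X Y Z = -torsionForm J g X Z Y := by
  simp only [torsionForm]
  rw [lie_apply_swap (J X) (J Y), lie_apply_swap (J Y) (J Z), lie_apply_swap (J Z) (J X)]
  ring

theorem bismutForm_swap_right (X Y Z : 𝔤) : bismutForm J g X Y Z = -bismutForm J g X Z Y := by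
  simp only [bismutForm]
  rw [torsionForm_swap_right, lie_apply_swap X Y, lie_apply_swap Y Z, lie_apply_swap Z X]
  ring

theorem bismutForm_sub_swap_left (X Y Z : 𝔤) :
    bismutForm J g X Y Z - bismutForm J g Y X Z = g ⁅X, Y⁆ Z + torsionForm J g X Y Z := by
  simp only [bismutForm]
  rw [torsionForm_swap_left Y X, lie_apply_swap Y X, lie_apply_swap X Z, lie_apply_swap Z Y]
  ring

theorem IsComplexStructure.lie_map_map (hJ : IsComplexStructure J) (X Y : 𝔤) :
    ⁅J X, J Y⁆ = ⁅X, Y⁆ + J (⁅J X, Y⁆ + ⁅X, J Y⁆) := by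
  rw [← sub_eq_zero, ← hJ.nijenhuis X Y, map_add]
  abel

theorem IsComplexStructure.apply_lie_map_map (hJ : IsComplexStructure J)
    (hg : IsHermitianMetric J g) (X Y Z : 𝔤) :
    g ⁅J X, J Y⁆ (J Z) = g ⁅X, Y⁆ (J Z) + g ⁅J X, Y⁆ Z + g ⁅X, J Y⁆ Z := by
  simp only [hJ.lie_map_map, map_add, LinearMap.add_apply, hg.map_map, add_assoc]

theorem bismutForm_map_middle (hJ : IsComplexStructure J) (hg : IsHermitianMetric J g)
    (X Y Z : 𝔤) : bismutForm J g X (J Y) Z = -bismutForm J g X Y (J Z) := by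
  have hXY := hJ.apply_lie_map_map hg X Y Z
  have hZX := hJ.apply_lie_map_map hg Z X Y
  simp only [bismutForm, torsionForm, hJ.map_map, neg_lie, lie_neg, map_neg, LinearMap.neg_apply]
  linarith

theorem isBismutProduct_of_apply_eq (hJ : IsComplexStructure J) (hg : IsHermitianMetric J g)
    {Γ : 𝔤 → 𝔤 → 𝔤} (hΓ : ∀ X Y Z, g (Γ X Y) Z = bismutForm J g X Y Z) :
    IsBismutProduct J g Γ where
  metric X Y Z := by rw [hg.symm Y, hΓ, hΓ, bismutForm_swap_right]
  complex X Y := eq_of_forall_apply_eq hg.pos fun Z => by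
    rw [hg.apply_map_left hJ.map_map, hΓ, hΓ, bismutForm_map_middle hJ hg]
  skew X Y Z := by
    have torsion (X Y Z : 𝔤) : g (Γ X Y - Γ Y X - ⁅X, Y⁆) Z = torsionForm J g X Y Z := by
      simp only [map_sub, LinearMap.sub_apply, hΓ, bismutForm_sub_swap_left, add_sub_cancel_left]
    rw [torsion, torsion, torsionForm_swap_right]

theorem exists_apply_eq_bismutForm [FiniteDimensional ℝ 𝔤] (hpos : ∀ X, X ≠ 0 → 0 < g X X)
    (J : 𝔤 →ₗ[ℝ] 𝔤) :
    ∃ Γ : 𝔤 →ₗ[ℝ] 𝔤 →ₗ[ℝ] 𝔤, ∀ X Y Z, g (Γ X Y) Z = bismutForm J g X Y Z := by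
  refine exists_bilinear_forall_apply_eq (nondegenerate_of_pos hpos) (LinearMap.mk₂ ℝ (fun X Y =>
    ({ toFun := bismutForm J g X Y, map_add' := ?_, map_smul' := ?_ } : 𝔤 →ₗ[ℝ] ℝ)) ?_ ?_ ?_ ?_)
  all_goals
    intros
    try ext
    simp only [bismutForm, torsionForm, map_add, map_smul, lie_add, add_lie, lie_smul, smul_lie,
      LinearMap.add_apply, LinearMap.smul_apply, smul_eq_mul, LinearMap.coe_mk, AddHom.coe_mk,
      RingHom.id_apply]
    ring

/-- The difference of two Bismut connections is a form `T` that is skew in all three variables.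
Moving `J` from one variable of `T` to another changes the sign; moving it around all three
variables gives `T = -T`. -/
theorem IsBismutProduct.eq (hJ : ∀ X, J (J X) = -X) (hg : IsHermitianMetric J g)
    {Γ Γ' : 𝔤 → 𝔤 → 𝔤} (hΓ : IsBismutProduct J g Γ) (hΓ' : IsBismutProduct J g Γ') :
    Γ = Γ' := by
  let T (X Y Z : 𝔤) : ℝ := g (Γ X Y) Z - g (Γ' X Y) Z
  have swap_right (X Y Z : 𝔤) : T X Y Z = -T X Z Y := by
    simp only [T, hΓ.metric X Y, hΓ'.metric X Y, hg.symm Y]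
    ring
  have swap_outer (X Y Z : 𝔤) : T X Y Z = -T Z Y X := by
    have h := hΓ.skew Y X Z
    have h' := hΓ'.skew Y X Z
    simp only [map_sub, LinearMap.sub_apply] at h h'
    linarith [swap_right Y X Z, swap_right Z Y X]
  have map_right (X Y Z : 𝔤) : T X Y (J Z) = -T X (J Y) Z := by
    simp only [T, hΓ.complex, hΓ'.complex, hg.apply_map_left hJ]
    ring
  have map_left (X Y Z : 𝔤) : T (J X) Y Z = -T X (J Y) Z := by
    rw [swap_outer, map_right, swap_outer Z, neg_neg]
  have eq_zero (X Y Z : 𝔤) : T X Y (J Z) = 0 := by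
    linarith [map_right X Y Z, map_left X Y Z, map_left X Z Y, swap_right (J X) Y Z,
      swap_right X Y (J Z)]
  funext X Y
  refine eq_of_forall_apply_eq hg.pos fun Z => ?_
  have h := eq_zero X Y (J Z)
  simp only [T, hJ, map_neg] at h
  linarith

/-- The curvature `R(X, Y)` of the connection given by `Γ` on left-invariant fields. -/
def productCurvature (Γ : 𝔤 →ₗ[ℝ] Module.End ℝ 𝔤) (X Y : 𝔤) : Module.End ℝ 𝔤 :=
  Γ X * Γ Y - Γ Y * Γ X - Γ ⁅X, Y⁆

section Trace

variable {ι : Type*} [Fintype ι]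

theorem trace_mul_productCurvature {Γ : 𝔤 →ₗ[ℝ] Module.End ℝ 𝔤} {Y : 𝔤}
    (hY : J * Γ Y = Γ Y * J) (X : 𝔤) :
    LinearMap.trace ℝ 𝔤 (J * productCurvature Γ X Y)
      = -LinearMap.trace ℝ 𝔤 (J * Γ ⁅X, Y⁆) := by
  have h : LinearMap.trace ℝ 𝔤 (J * (Γ Y * Γ X)) = LinearMap.trace ℝ 𝔤 (J * (Γ X * Γ Y)) := by
    rw [← mul_assoc, hY, mul_assoc, LinearMap.trace_mul_comm, mul_assoc]
  rw [productCurvature, mul_sub, mul_sub, map_sub, map_sub, h, sub_self, zero_sub]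

theorem IsBismutProduct.sum_productCurvature [DecidableEq ι] (hJ : ∀ X, J (J X) = -X)
    (hg : IsHermitianMetric J g) {Γ : 𝔤 →ₗ[ℝ] Module.End ℝ 𝔤}
    (hΓ : IsBismutProduct J g fun X Y => Γ X Y) {E : Module.Basis ι ℝ 𝔤}
    (hE : ∀ i j, g (E i) (E j) = if i = j then 1 else 0) (X Y : 𝔤) :
    ∑ i, g (productCurvature Γ X Y (E i)) (J (E i)) = LinearMap.trace ℝ 𝔤 (J * Γ ⁅X, Y⁆) := by
  have hE' : g.IsOrthoᵢ E := fun i j hij => (hE i j).trans (if_neg hij)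
  rw [← neg_neg (LinearMap.trace ℝ 𝔤 _),
    ← trace_mul_productCurvature (LinearMap.ext fun Z => (hΓ.complex Y Z).symm),
    trace_eq_sum_of_isOrthoᵢ hE' (by simp [hE]), ← Finset.sum_neg_distrib]
  simp only [Module.End.mul_apply, hg.apply_map_left hJ, hE, if_true, div_one, neg_neg]

theorem two_mul_bismutForm_map_right (hJ : ∀ X, J (J X) = -X) (hg : IsHermitianMetric J g)
    (X Y : 𝔤) :
    2 * bismutForm J g X Y (J Y) = -g (J ⁅X, Y⁆) Y - g ⁅X, J Y⁆ Y + g (J ⁅J X, J Y⁆) Y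
      - g ⁅J X, Y⁆ Y - 2 * g ⁅Y, J Y⁆ X := by
  simp only [bismutForm, torsionForm, hJ, hg.apply_map_left hJ, lie_neg, neg_lie, map_neg,
    LinearMap.neg_apply]
  linarith [lie_apply_swap (g := g) (J Y) X Y, lie_apply_swap (g := g) (J Y) Y X,
    lie_apply_swap (g := g) Y (J X) Y]

theorem trace_mul_eq_trace_mul_ad_add_sum (hJ : ∀ X, J (J X) = -X) (hg : IsHermitianMetric J g)
    (had : ∀ X, LinearMap.trace ℝ 𝔤 (LieAlgebra.ad ℝ 𝔤 X) = 0)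
    {Γ : 𝔤 →ₗ[ℝ] Module.End ℝ 𝔤} (hΓ : ∀ X Y Z, g (Γ X Y) Z = bismutForm J g X Y Z)
    {E : Module.Basis ι ℝ 𝔤} (hE : g.IsOrthoᵢ E) (X : 𝔤) :
    LinearMap.trace ℝ 𝔤 (J * Γ X) = LinearMap.trace ℝ 𝔤 (J * LieAlgebra.ad ℝ 𝔤 X)
      + ∑ i, g ⁅E i, J (E i)⁆ X / g (E i) (E i) := by
  let ad := LieAlgebra.ad ℝ 𝔤
  have hJJ : J * J = -1 := LinearMap.ext hJ
  have trace_comm : LinearMap.trace ℝ 𝔤 (ad X * J) = LinearMap.trace ℝ 𝔤 (J * ad X) :=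
    LinearMap.trace_mul_comm ..
  have trace_conj : LinearMap.trace ℝ 𝔤 (J * ad (J X) * J) = 0 := by
    rw [LinearMap.trace_mul_comm, ← mul_assoc, hJJ, neg_one_mul, map_neg, had, neg_zero]
  have key : 2 * LinearMap.trace ℝ 𝔤 (J * Γ X)
      = LinearMap.trace ℝ 𝔤 (J * ad X) + LinearMap.trace ℝ 𝔤 (ad X * J)
        - LinearMap.trace ℝ 𝔤 (J * ad (J X) * J) + LinearMap.trace ℝ 𝔤 (ad (J X))
        + 2 * ∑ i, g ⁅E i, J (E i)⁆ X / g (E i) (E i) := by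
    simp only [trace_eq_sum_of_isOrthoᵢ hE fun i => (hg.pos _ (E.ne_zero i)).ne', Finset.mul_sum,
      ← Finset.sum_add_distrib, ← Finset.sum_sub_distrib]
    refine Finset.sum_congr rfl fun i _ => ?_
    have h := two_mul_bismutForm_map_right hJ hg X (E i)
    simp only [Module.End.mul_apply, ad, LieAlgebra.ad_apply]
    rw [hg.apply_map_left hJ (Γ X _), hΓ]
    linear_combination -h / g (E i) (E i)
  linarith [had (J X)]

theorem trace_ad_eq_zero [FiniteDimensional ℝ 𝔤] (hsymm : ∀ X Y, g X Y = g Y X)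
    (hpos : ∀ X, X ≠ 0 → 0 < g X X) (hg_lie : ∀ X Y Z, g ⁅X, Y⁆ Z = g X ⁅Y, Z⁆) (X : 𝔤) :
    LinearMap.trace ℝ 𝔤 (LieAlgebra.ad ℝ 𝔤 X) = 0 := by
  obtain ⟨E, hE⟩ := exists_basis_orthonormal hsymm hpos
  rw [trace_eq_sum_of_isOrthoᵢ (fun i j hij => (hE i j).trans (if_neg hij)) (by simp [hE])]
  simp only [LieAlgebra.ad_apply, hg_lie, lie_self, map_zero, zero_div, Finset.sum_const_zero]

theorem trace_mul_ad_eq_neg_sum (hJ : ∀ X, J (J X) = -X) (hg : IsHermitianMetric J g)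
    (hg_lie : ∀ X Y Z, g ⁅X, Y⁆ Z = g X ⁅Y, Z⁆) {E : Module.Basis ι ℝ 𝔤} (hE : g.IsOrthoᵢ E)
    (X : 𝔤) :
    LinearMap.trace ℝ 𝔤 (J * LieAlgebra.ad ℝ 𝔤 X)
      = -∑ i, g ⁅E i, J (E i)⁆ X / g (E i) (E i) := by
  rw [trace_eq_sum_of_isOrthoᵢ hE fun i => (hg.pos _ (E.ne_zero i)).ne', ← Finset.sum_neg_distrib]
  refine Finset.sum_congr rfl fun i _ => ?_
  rw [Module.End.mul_apply, LieAlgebra.ad_apply, hg.apply_map_left hJ, hg_lie, hg.symm, neg_div]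

variable {b : 𝔤 →ₗ[ℝ] 𝔤 →ₗ[ℝ] ℝ} {e : ι → 𝔤}

theorem trace_mul_eq_two_mul_sum (hJ : ∀ X, J (J X) = -X)
    (hg : IsHermitianMetric J g) (hb : IsHermitianMetric J b)
    (hb_lie : ∀ X Y Z, b ⁅X, Y⁆ Z = b X ⁅Y, Z⁆) {Γ : 𝔤 →ₗ[ℝ] Module.End ℝ 𝔤}
    (hΓ : ∀ X Y Z, g (Γ X Y) Z = bismutForm J g X Y Z) {E : Module.Basis (ι ⊕ ι) ℝ 𝔤}
    (hE : ⇑E = Sum.elim e (J ∘ e)) (hgE : g.IsOrthoᵢ E) (hbE : b.IsOrthoᵢ E) (X : 𝔤) :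
    LinearMap.trace ℝ 𝔤 (J * Γ X) = 2 * ∑ i, (g ⁅e i, J (e i)⁆ X / g (e i) (e i)
      - b ⁅e i, J (e i)⁆ X / b (e i) (e i)) := by
  have : FiniteDimensional ℝ 𝔤 := Module.Finite.of_basis E
  rw [trace_mul_eq_trace_mul_ad_add_sum hJ hg (trace_ad_eq_zero hb.symm hb.pos hb_lie) hΓ hgE,
    trace_mul_ad_eq_neg_sum hJ hb hb_lie hbE]
  simp only [hE, Fintype.sum_sum_type, Sum.elim_inl, Sum.elim_inr, Function.comp_apply, hJ,
    lie_neg, lie_skew, hg.map_map, hb.map_map, Finset.sum_sub_distrib]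
  ring

end Trace

end Bismut

namespace SU3Geometry

/-! ### The Lie algebra `su3` -/

theorem conjTranspose_mul_self (U : SU3) : (U : Mat3)ᴴ * (U : Mat3) = 1 :=
  Matrix.mem_unitaryGroup_iff'.1 (Matrix.mem_specialUnitaryGroup_iff.1 U.2).1

theorem mul_conjTranspose_self (U : SU3) : (U : Mat3) * (U : Mat3)ᴴ = 1 :=
  Matrix.mem_unitaryGroup_iff.1 (Matrix.mem_specialUnitaryGroup_iff.1 U.2).1

theorem coe_bracket (X Y : su3) : (bracket X Y : Mat3) = (X : Mat3) * Y - (Y : Mat3) * X := rfl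

instance : LieRing su3 where
  bracket := bracket
  add_lie X Y Z := Subtype.ext <| by
    simp only [coe_bracket, Submodule.coe_add, add_mul, mul_add]
    abel
  lie_add X Y Z := Subtype.ext <| by
    simp only [coe_bracket, Submodule.coe_add, add_mul, mul_add]
    abel
  lie_self X := Subtype.ext (sub_self _)
  leibniz_lie X Y Z := Subtype.ext <| by
    simp only [coe_bracket, Submodule.coe_add, sub_mul, mul_sub, mul_assoc]
    abel

instance : LieAlgebra ℝ su3 where
  lie_smul c X Y := Subtype.ext <| by
    change (X : Mat3) * (c • Y : Mat3) - (c • Y : Mat3) * X = c • ((X : Mat3) * Y - (Y : Mat3) * X)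
    rw [mul_smul_comm, smul_mul_assoc, smul_sub]

theorem coe_lie (X Y : su3) : (⁅X, Y⁆ : su3) = (X : Mat3) * Y - (Y : Mat3) * X := rfl

theorem B_apply (X Y : su3) : B X Y = -6 * ((X : Mat3) * (Y : Mat3)).trace.re := rfl

theorem B_comm (X Y : su3) : B X Y = B Y X := by
  rw [B_apply, B_apply, Matrix.trace_mul_comm]

theorem B_lie (X Y Z : su3) : B ⁅X, Y⁆ Z = B X ⁅Y, Z⁆ := by
  simp only [B_apply, coe_lie, sub_mul, mul_sub, Matrix.trace_sub, mul_assoc]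
  rw [Matrix.trace_mul_comm (Y : Mat3) (X * Z), mul_assoc]

theorem trace_mul_eq_neg_B_div_six (X Y : su3) :
    ((X : Mat3) * (Y : Mat3)).trace = ((-(B X Y) / 6 : ℝ) : ℂ) := by
  have h : star ((X : Mat3) * (Y : Mat3)).trace = ((X : Mat3) * (Y : Mat3)).trace := by
    rw [← Matrix.trace_conjTranspose, Matrix.conjTranspose_mul, X.2.1, Y.2.1, neg_mul_neg,
      Matrix.trace_mul_comm]
  rw [← Complex.conj_eq_iff_re.1 h, B_apply]
  congr 1
  ring

section HolomorphicSubalgebra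

attribute [local instance] LieRing.ofAssociativeRing

variable {J : su3 →ₗ[ℝ] su3}

/-- The `i`-eigenspace of the complex-linear extension of the complex structure `J`. -/
def holomorphicSubalgebra (hJ : IsComplexStructure J) : LieSubalgebra ℂ Mat3 where
  carrier := {M | ∃ X : su3, M = (X : Mat3) - Complex.I • (J X : Mat3)}
  add_mem' := by
    rintro _ _ ⟨X, rfl⟩ ⟨Y, rfl⟩
    refine ⟨X + Y, ?_⟩
    rw [map_add, Submodule.coe_add, Submodule.coe_add, smul_add]
    abel
  zero_mem' := ⟨0, by simp⟩
  smul_mem' := by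
    rintro c _ ⟨X, rfl⟩
    refine ⟨c.re • X + c.im • J X, ?_⟩
    rw [map_add, map_smul, map_smul, hJ.map_map]
    ext i j
    simp only [Matrix.smul_apply, Matrix.sub_apply, Matrix.add_apply, Submodule.coe_add,
      Submodule.coe_smul, Submodule.coe_neg, Matrix.neg_apply, smul_eq_mul, Complex.real_smul]
    conv_lhs => rw [← Complex.re_add_im c]
    linear_combination (-(c.im : ℂ) * (J X : Mat3) i j) * Complex.I_mul_I
  lie_mem' := by
    rintro _ _ ⟨X, rfl⟩ ⟨Y, rfl⟩
    refine ⟨⁅X, Y⁆ - ⁅J X, J Y⁆, ?_⟩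
    have h : J (⁅X, Y⁆ - ⁅J X, J Y⁆) = ⁅J X, Y⁆ + ⁅X, J Y⁆ := by
      rw [hJ.lie_map_map, sub_add_cancel_left, map_neg, hJ.map_map, neg_neg]
    rw [h, LieRing.of_associative_ring_bracket]
    simp only [Submodule.coe_sub, Submodule.coe_add, coe_lie, sub_mul, mul_sub,
      smul_mul_assoc, mul_smul_comm, smul_smul, Complex.I_mul_I, smul_add, smul_sub, neg_smul,
      one_smul]
    abel

theorem trace_mul_eq_zero_of_mem_holomorphicSubalgebra (hJ : IsComplexStructure J)
    (hB : IsHermitianMetric J B) {M N : Mat3} (hM : M ∈ holomorphicSubalgebra hJ)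
    (hN : N ∈ holomorphicSubalgebra hJ) : (M * N).trace = 0 := by
  obtain ⟨X, rfl⟩ := hM
  obtain ⟨Y, rfl⟩ := hN
  simp only [sub_mul, mul_sub, smul_mul_assoc, mul_smul_comm, Matrix.trace_sub,
    Matrix.trace_smul, trace_mul_eq_neg_B_div_six, smul_eq_mul, hB.map_map,
    hB.apply_map_left hJ.map_map]
  push_cast
  linear_combination (-(B X Y) / 6 : ℂ) * Complex.I_mul_I

end HolomorphicSubalgebra

/-! ### Left-invariant tensor fields -/

section Calculus

variable {V V' W : Type*} [NormedAddCommGroup V] [NormedSpace ℝ V] [NormedAddCommGroup V']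
  [NormedSpace ℝ V'] [NormedAddCommGroup W] [NormedSpace ℝ W]

section Exp

attribute [local instance] Matrix.linftyOpNormedRing Matrix.linftyOpNormedAlgebra

theorem hasDerivAt_mul_exp_smul (P A : Mat3) :
    HasDerivAt (fun t : ℝ => P * NormedSpace.exp (t • A)) (P * A) 0 := by
  have h := (hasDerivAt_exp_smul_const (𝕂 := ℝ) A (0 : ℝ)).const_mul P
  rwa [zero_smul, NormedSpace.exp_zero, one_mul] at h

theorem contDiff_mul {n : WithTop ℕ∞} {F G : V → Mat3} (hF : ContDiff ℝ n F)
    (hG : ContDiff ℝ n G) : ContDiff ℝ n (fun x => F x * G x) := hF.mul hG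

end Exp

theorem mul_expSU3_zero_smul (p : SU3) (A : su3) : p * expSU3 ((0 : ℝ) • A) = p := by
  apply Subtype.ext
  change (p : Mat3) * NormedSpace.exp (((0 : ℝ) • A : su3) : Mat3) = p
  rw [zero_smul, Submodule.coe_zero, NormedSpace.exp_zero, mul_one]

theorem hasDerivAt_mul_expSU3_smul {F : Mat3 → V} (hF : ContDiff ℝ ∞ F) {f : SU3 → V}
    (hf : ∀ p : SU3, F p = f p) (A : su3) (p : SU3) :
    HasDerivAt (fun t : ℝ => f (p * expSU3 (t • A))) (fderiv ℝ F p ((p : Mat3) * A)) 0 := by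
  have hp : (p : Mat3) * NormedSpace.exp ((0 : ℝ) • (A : Mat3)) = p :=
    congrArg Subtype.val (mul_expSU3_zero_smul p A)
  have hFp : HasFDerivAt F (fderiv ℝ F p)
      ((p : Mat3) * NormedSpace.exp ((0 : ℝ) • (A : Mat3))) := by
    rw [hp]
    exact (hF.differentiable (by simp) _).hasFDerivAt
  exact (hFp.comp_hasDerivAt (0 : ℝ) (hasDerivAt_mul_exp_smul p A)).congr_of_eventuallyEq
    (.of_forall fun t => (hf _).symm)

theorem fieldDeriv_eq_fderiv {F : Mat3 → V} (hF : ContDiff ℝ ∞ F) {f : SU3 → V}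
    (hf : ∀ p : SU3, F p = f p) (X : SU3 → su3) (p : SU3) :
    fieldDeriv X f p = fderiv ℝ F p ((p : Mat3) * X p) :=
  (hasDerivAt_mul_expSU3_smul hF hf (X p) p).deriv

theorem IsSmooth.hasDerivAt {f : SU3 → V} (hf : IsSmooth f) (X : SU3 → su3) (p : SU3) :
    HasDerivAt (fun t : ℝ => f (p * expSU3 (t • X p))) (fieldDeriv X f p) 0 := by
  obtain ⟨F, hF, hFf⟩ := hf
  rw [fieldDeriv_eq_fderiv hF hFf]
  exact hasDerivAt_mul_expSU3_smul hF hFf (X p) p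

theorem isSmooth_const (v : V) : IsSmooth (fun _ : SU3 => v) :=
  ⟨fun _ => v, contDiff_const, fun _ => rfl⟩

theorem IsSmooth.add {f g : SU3 → V} (hf : IsSmooth f) (hg : IsSmooth g) :
    IsSmooth (fun p => f p + g p) := by
  obtain ⟨F, hF, hFf⟩ := hf
  obtain ⟨G, hG, hGg⟩ := hg
  exact ⟨fun M => F M + G M, hF.add hG, fun p => by simp only [hFf, hGg]⟩

theorem IsSmooth.bilinear (L : V →L[ℝ] V' →L[ℝ] W) {f : SU3 → V} {g : SU3 → V'} (hf : IsSmooth f)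
    (hg : IsSmooth g) : IsSmooth (fun p => L (f p) (g p)) := by
  obtain ⟨F, hF, hFf⟩ := hf
  obtain ⟨G, hG, hGg⟩ := hg
  exact ⟨fun M => L (F M) (G M), (L.contDiff.comp hF).clm_apply hG, fun p => by
    simp only [hFf, hGg]⟩

theorem IsSmooth.fieldDeriv {X : SU3 → su3} (hX : IsSmooth X) {f : SU3 → V} (hf : IsSmooth f) :
    IsSmooth (fieldDeriv X f) := by
  obtain ⟨F, hF, hFf⟩ := hf
  obtain ⟨G, hG, hGX⟩ := hX
  refine ⟨fun M => fderiv ℝ F M (M * (G M : Mat3)), ?_, fun p => ?_⟩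
  · exact (hF.fderiv_right (m := ∞) (by simp)).clm_apply
      (contDiff_mul contDiff_id (su3.subtypeL.contDiff.comp hG))
  · simp only [fieldDeriv_eq_fderiv hF hFf, hGX]

theorem fieldDeriv_const (X : SU3 → su3) (v : V) (p : SU3) : fieldDeriv X (fun _ => v) p = 0 :=
  deriv_const ..

theorem fieldDeriv_add_left (X Y : SU3 → su3) {f : SU3 → V} (hf : IsSmooth f) (p : SU3) :
    fieldDeriv (X + Y) f p = fieldDeriv X f p + fieldDeriv Y f p := by
  obtain ⟨F, hF, hFf⟩ := hf
  simp only [fieldDeriv_eq_fderiv hF hFf, Pi.add_apply, Submodule.coe_add, mul_add, map_add]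

theorem fieldDeriv_smul_left (c : SU3 → ℝ) (X : SU3 → su3) {f : SU3 → V} (hf : IsSmooth f)
    (p : SU3) : fieldDeriv (fun q => c q • X q) f p = c p • fieldDeriv X f p := by
  obtain ⟨F, hF, hFf⟩ := hf
  simp only [fieldDeriv_eq_fderiv hF hFf, Submodule.coe_smul, mul_smul_comm, map_smul]

theorem fieldDeriv_add (X : SU3 → su3) {f g : SU3 → V} (hf : IsSmooth f) (hg : IsSmooth g)
    (p : SU3) : fieldDeriv X (f + g) p = fieldDeriv X f p + fieldDeriv X g p :=
  ((hf.hasDerivAt X p).add (hg.hasDerivAt X p)).deriv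

theorem fieldDeriv_clm (L : V →L[ℝ] W) (X : SU3 → su3) {f : SU3 → V} (hf : IsSmooth f) (p : SU3) :
    fieldDeriv X (fun q => L (f q)) p = L (fieldDeriv X f p) :=
  (L.hasFDerivAt.comp_hasDerivAt _ (hf.hasDerivAt X p)).deriv

theorem fieldDeriv_bilinear (L : V →L[ℝ] V' →L[ℝ] W) (X : SU3 → su3) {f : SU3 → V} {g : SU3 → V'}
    (hf : IsSmooth f) (hg : IsSmooth g) (p : SU3) :
    fieldDeriv X (fun q => L (f q) (g q)) p
      = L (fieldDeriv X f p) (g p) + L (f p) (fieldDeriv X g p) := by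
  have h := ((L.hasFDerivAt.comp_hasDerivAt _ (hf.hasDerivAt X p)).clm_apply
    (hg.hasDerivAt X p)).deriv
  simp only [Function.comp_apply, mul_expSU3_zero_smul] at h
  exact h

theorem fieldDeriv_smul (X : SU3 → su3) {c : SU3 → ℝ} (hc : IsSmooth c) {f : SU3 → V}
    (hf : IsSmooth f) (p : SU3) :
    fieldDeriv X (fun q => c q • f q) p = fieldDeriv X c p • f p + c p • fieldDeriv X f p :=
  fieldDeriv_bilinear (ContinuousLinearMap.lsmul ℝ ℝ) X hc hf p

end Calculus

theorem fieldBracket_const (X Y : su3) (p : SU3) :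
    fieldBracket (fun _ => X) (fun _ => Y) p = ⁅X, Y⁆ := by
  rw [fieldBracket, fieldDeriv_const, fieldDeriv_const, sub_zero, zero_add]
  rfl

section LeftInvariant

variable {J : su3 →ₗ[ℝ] su3} {g : su3 →ₗ[ℝ] su3 →ₗ[ℝ] ℝ}

theorem IsInvariantComplexStructure.isComplexStructure (hJ : IsInvariantComplexStructure J) :
    IsComplexStructure J where
  map_map := hJ.sq_eq_neg
  nijenhuis X Y := by
    have h := hJ.nijenhuis (fun _ => X) (fun _ => Y) (isSmooth_const X) (isSmooth_const Y) 1
    simpa only [fieldBracket_const] using h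

theorem isInvariantHermitianMetric_iff :
    IsInvariantHermitianMetric J g ↔ IsHermitianMetric J g :=
  ⟨fun h => ⟨h.symm, h.pos, h.hermitian⟩, fun h => ⟨h.symm, h.pos, h.map_map⟩⟩

/-- The left-invariant connection that is given by the product `Γ` on left-invariant fields. -/
def leftInvariantConnection (Γ : su3 →ₗ[ℝ] Module.End ℝ su3) (X Y : SU3 → su3) (p : SU3) : su3 :=
  fieldDeriv X Y p + Γ (X p) (Y p)

variable {Γ : su3 →ₗ[ℝ] Module.End ℝ su3}

theorem isConnection_leftInvariantConnection (Γ : su3 →ₗ[ℝ] Module.End ℝ su3) :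
    IsConnection (leftInvariantConnection Γ) where
  smooth X Y hX hY := (hX.fieldDeriv hY).add (hX.bilinear Γ.toContinuousBilinearMap hY)
  add_left X X' Y _ _ hY := by
    funext p
    simp only [leftInvariantConnection, fieldDeriv_add_left X X' hY, Pi.add_apply, map_add,
      LinearMap.add_apply]
    abel
  smul_left f X Y _ _ hY := by
    funext p
    simp only [leftInvariantConnection, fieldDeriv_smul_left f X hY, map_smul,
      LinearMap.smul_apply, smul_add]
  add_right X Y Y' _ hY hY' := by
    funext p
    simp only [leftInvariantConnection, fieldDeriv_add X hY hY', Pi.add_apply, map_add]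
    abel
  leibniz f X Y hf _ hY := by
    funext p
    simp only [leftInvariantConnection, fieldDeriv_smul X hf hY, map_smul, smul_add, add_assoc]

theorem torsion_leftInvariantConnection (X Y : SU3 → su3) (p : SU3) :
    torsion (leftInvariantConnection Γ) X Y p
      = Γ (X p) (Y p) - Γ (Y p) (X p) - ⁅X p, Y p⁆ := by
  simp only [torsion, leftInvariantConnection, fieldBracket]
  change _ = _ - _ - bracket (X p) (Y p)
  abel

theorem curvature_leftInvariantConnection {X Y : SU3 → su3} (hX : IsSmooth X) (hY : IsSmooth Y)
    (Z : su3) (p : SU3) : curvature (leftInvariantConnection Γ) X Y (fun _ => Z) p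
      = productCurvature Γ (X p) (Y p) Z := by
  have apply_const (W : SU3 → su3) :
      leftInvariantConnection Γ W (fun _ => Z) = fun q => Γ (W q) Z := by
    funext q
    rw [leftInvariantConnection, fieldDeriv_const, zero_add]
  have fieldDeriv_apply (V : SU3 → su3) {W : SU3 → su3} (hW : IsSmooth W) :
      fieldDeriv V (fun q => Γ (W q) Z) p = Γ (fieldDeriv V W p) Z :=
    fieldDeriv_clm (LinearMap.toContinuousLinearMap (LinearMap.flip Γ Z)) V hW p
  have lie_eq : ⁅X p, Y p⁆ = bracket (X p) (Y p) := rfl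
  simp only [curvature, apply_const, productCurvature, lie_eq, LinearMap.sub_apply,
    Module.End.mul_apply]
  simp only [leftInvariantConnection, fieldDeriv_apply _ hX, fieldDeriv_apply _ hY, fieldBracket,
    map_add, map_sub, LinearMap.add_apply, LinearMap.sub_apply]
  abel

theorem isBismutConnection_leftInvariantConnection (hΓ : IsBismutProduct J g fun X Y => Γ X Y) :
    IsBismutConnection J g (leftInvariantConnection Γ) where
  toIsConnection := isConnection_leftInvariantConnection Γ
  metric X Y Z _ hY hZ p := by
    have h : fieldDeriv X (fun q => g (Y q) (Z q)) p
        = g (fieldDeriv X Y p) (Z p) + g (Y p) (fieldDeriv X Z p) :=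
      fieldDeriv_bilinear g.toContinuousBilinearMap X hY hZ p
    rw [h]
    simp only [leftInvariantConnection, map_add, LinearMap.add_apply, hΓ.metric (X p) (Y p)]
    ring
  complex X Y _ hY p := by
    have h : fieldDeriv X (fun q => J (Y q)) p = J (fieldDeriv X Y p) :=
      fieldDeriv_clm (LinearMap.toContinuousLinearMap J) X hY p
    simp only [leftInvariantConnection, h, hΓ.complex, map_add]
  skew X Y Z _ _ _ p := by
    simp only [torsion_leftInvariantConnection]
    exact hΓ.skew ..

theorem IsBismutConnection.isBismutProduct {D : (SU3 → su3) → (SU3 → su3) → SU3 → su3}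
    (hD : IsBismutConnection J g D) (p : SU3) :
    IsBismutProduct J g fun X Y => D (fun _ => X) (fun _ => Y) p where
  metric X Y Z := by
    have h := hD.metric _ _ _ (isSmooth_const X) (isSmooth_const Y) (isSmooth_const Z) p
    rw [fieldDeriv_const] at h
    linarith
  complex X Y := hD.complex _ _ (isSmooth_const X) (isSmooth_const Y) p
  skew X Y Z := by
    have h := hD.skew _ _ _ (isSmooth_const X) (isSmooth_const Y) (isSmooth_const Z) p
    simpa only [torsion, fieldBracket_const] using h

theorem IsBismutConnection.apply_const (hJ : ∀ X, J (J X) = -X) (hg : IsHermitianMetric J g)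
    {D : (SU3 → su3) → (SU3 → su3) → SU3 → su3} (hD : IsBismutConnection J g D)
    (hΓ : IsBismutProduct J g fun X Y => Γ X Y) (X Y : su3) :
    D (fun _ => X) (fun _ => Y) = fun _ => Γ X Y :=
  funext fun p => congrFun₂ ((hD.isBismutProduct p).eq hJ hg hΓ) X Y

theorem isCYT_iff_trace_eq_zero (hJ : ∀ X, J (J X) = -X) (hg : IsHermitianMetric J g)
    (hΓ : IsBismutProduct J g fun X Y => Γ X Y) :
    IsCYT J g ↔ ∀ X Y : su3, LinearMap.trace ℝ su3 (J * Γ ⁅X, Y⁆) = 0 := by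
  constructor
  · rintro ⟨D, hD, hE⟩ X Y
    obtain ⟨E, hE_orthonormal⟩ := exists_basis_orthonormal hg.symm hg.pos
    have curvature_eq (Z : su3) :
        curvature D (fun _ => X) (fun _ => Y) (fun _ => Z) 1 = productCurvature Γ X Y Z := by
      rw [curvature, funext (fieldBracket_const X Y)]
      simp only [hD.apply_const hJ hg hΓ]
      rfl
    have h := hE E hE_orthonormal _ _ (isSmooth_const X) (isSmooth_const Y) 1
    simpa only [ricciForm, curvature_eq, hΓ.sum_productCurvature hJ hg hE_orthonormal] using h
  · intro h
    refine ⟨_, isBismutConnection_leftInvariantConnection hΓ, fun E hE X Y hX hY p => ?_⟩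
    simp only [ricciForm, curvature_leftInvariantConnection hX hY,
      hΓ.sum_productCurvature hJ hg hE, h]

end LeftInvariant

/-! ### Unitary frames -/

/-- The matrix of an element of `𝔰𝔲(3)` in the unitary frame `U`. -/
def inFrame (U : SU3) : su3 →ₗ[ℝ] Mat3 where
  toFun X := (U : Mat3)ᴴ * X * (U : Mat3)
  map_add' X Y := by simp [mul_add, add_mul]
  map_smul' c X := by simp

section Frame

variable (U : SU3)

theorem inFrame_apply (X : su3) : inFrame U X = (U : Mat3)ᴴ * X * (U : Mat3) := rfl

theorem conj_mul_conj (M N : Mat3) :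
    ((U : Mat3)ᴴ * M * (U : Mat3)) * ((U : Mat3)ᴴ * N * (U : Mat3))
      = (U : Mat3)ᴴ * (M * N) * (U : Mat3) := by
  simp only [mul_assoc]
  rw [← mul_assoc (U : Mat3) (U : Mat3)ᴴ, mul_conjTranspose_self, one_mul]

theorem conj_conjTranspose_conj (M : Mat3) :
    (U : Mat3)ᴴ * ((U : Mat3) * M * (U : Mat3)ᴴ) * (U : Mat3) = M := by
  rw [← mul_assoc, ← mul_assoc, conjTranspose_mul_self, one_mul, mul_assoc,
    conjTranspose_mul_self, mul_one]

theorem trace_conj (M : Mat3) : ((U : Mat3)ᴴ * M * (U : Mat3)).trace = M.trace := by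
  rw [Matrix.trace_mul_comm, ← mul_assoc, mul_conjTranspose_self, one_mul]

theorem inFrame_injective : Function.Injective (inFrame U) := by
  intro X Y h
  have h' := congrArg (fun M => (U : Mat3) * M * (U : Mat3)ᴴ) h
  simp only [inFrame_apply, ← mul_assoc, mul_conjTranspose_self, one_mul] at h'
  simpa only [mul_assoc, mul_conjTranspose_self, mul_one, Subtype.coe_inj] using h'

theorem inFrame_Ad (X : su3) : inFrame U (Ad U X) = X := conj_conjTranspose_conj U X

theorem inFrame_lie (X Y : su3) :
    inFrame U ⁅X, Y⁆ = inFrame U X * inFrame U Y - inFrame U Y * inFrame U X := by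
  simp only [inFrame_apply, conj_mul_conj, coe_lie, mul_sub, sub_mul]

theorem inFrame_Lam_apply (a b c : ℝ) (X : su3) (j k : Fin 3) :
    inFrame U (Lam U a b c X) j k = weights a b c j k * inFrame U X j k :=
  congrFun₂ (conj_conjTranspose_conj U _) j k

theorem inFrame_swap (X : su3) (j k : Fin 3) : inFrame U X k j = -star (inFrame U X j k) := by
  have h : (inFrame U X)ᴴ = -inFrame U X := by
    simp only [inFrame_apply, Matrix.conjTranspose_mul, Matrix.conjTranspose_conjTranspose, X.2.1,
      mul_neg, neg_mul, mul_assoc]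
  rw [← Matrix.conjTranspose_apply, h, Matrix.neg_apply, neg_neg]

theorem inFrame_diag_eq_im_mul_I (X : su3) (j : Fin 3) :
    inFrame U X j j = ((inFrame U X j j).im : ℂ) * Complex.I := by
  have h := congrArg Complex.re (inFrame_swap U X j j)
  rw [Complex.neg_re, Complex.star_def, Complex.conj_re, self_eq_neg] at h
  exact Complex.ext (by simp [h]) (by simp)

theorem inFrame_two_two_im (X : su3) :
    (inFrame U X 2 2).im = -(inFrame U X 0 0).im - (inFrame U X 1 1).im := by
  have h := congrArg Complex.im ((trace_conj U X).trans X.2.2)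
  rw [← inFrame_apply, Matrix.trace_fin_three, Complex.add_im, Complex.add_im, Complex.zero_im] at h
  linarith

theorem B_eq_trace_inFrame (X Y : su3) :
    B X Y = -6 * (inFrame U X * inFrame U Y).trace.re := by
  rw [inFrame_apply, inFrame_apply, conj_mul_conj, trace_conj, B_apply]

theorem B_eq_sum_inFrame (X Y : su3) :
    B X Y = 6 * ∑ j, ∑ k, (inFrame U X j k * star (inFrame U Y j k)).re := by
  simp only [B_eq_trace_inFrame U, Matrix.trace, Matrix.diag_apply, Matrix.mul_apply,
    Complex.re_sum, Finset.mul_sum]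
  refine Finset.sum_congr rfl fun j _ => Finset.sum_congr rfl fun k _ => ?_
  rw [inFrame_swap U Y j k, mul_neg, Complex.neg_re]
  ring

theorem weights_eq_ofReal_re (a b c : ℝ) (j k : Fin 3) :
    weights a b c j k = ((weights a b c j k).re : ℂ) := by
  fin_cases j <;> fin_cases k <;> simp [weights]

theorem weights_re_pos {a b c : ℝ} (ha : 0 < a) (hb : 0 < b) (hc : 0 < c) (j k : Fin 3) :
    0 < (weights a b c j k).re := by
  fin_cases j <;> fin_cases k <;> simp [weights, ha, hb, hc]

theorem weights_diag (a b c : ℝ) (j : Fin 3) : weights a b c j j = 1 := by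
  fin_cases j <;> rfl

theorem metric_apply (a b c : ℝ) (X Y : su3) : metric U a b c X Y = B (Lam U a b c X) Y := rfl

theorem metric_eq_sum_inFrame (a b c : ℝ) (X Y : su3) : metric U a b c X Y
    = 6 * ∑ j, ∑ k,
      (weights a b c j k).re * (inFrame U X j k * star (inFrame U Y j k)).re := by
  simp only [metric_apply, B_eq_sum_inFrame U, inFrame_Lam_apply, mul_assoc]
  congr! 5 with j _ k
  rw [weights_eq_ofReal_re, Complex.re_ofReal_mul, Complex.ofReal_re]

theorem Lam_eq_self (a b c : ℝ) {X : su3} (hX : (inFrame U X).IsDiag) : Lam U a b c X = X := by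
  refine inFrame_injective U (Matrix.ext fun j k => ?_)
  rw [inFrame_Lam_apply]
  obtain rfl | hjk := eq_or_ne j k
  · rw [weights_diag, one_mul]
  · rw [hX hjk, mul_zero]

theorem metric_symm (a b c : ℝ) (X Y : su3) : metric U a b c X Y = metric U a b c Y X := by
  have re_mul_star (z w : ℂ) : (z * star w).re = (w * star z).re := by
    rw [← star_star z, ← star_mul, star_star, Complex.star_def, Complex.conj_re]
  simp only [metric_eq_sum_inFrame, re_mul_star (inFrame U X _ _)]

theorem metric_pos {a b c : ℝ} (ha : 0 < a) (hb : 0 < b) (hc : 0 < c) {X : su3} (hX : X ≠ 0) :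
    0 < metric U a b c X X := by
  have summand_nonneg (j k : Fin 3) :
      0 ≤ (weights a b c j k).re * Complex.normSq (inFrame U X j k) :=
    mul_nonneg (weights_re_pos ha hb hc j k).le (Complex.normSq_nonneg _)
  obtain ⟨j, k, hjk⟩ : ∃ j k, inFrame U X j k ≠ 0 := by
    by_contra! h
    exact hX (inFrame_injective U ((Matrix.ext h).trans (map_zero _).symm))
  simp only [metric_eq_sum_inFrame, Complex.star_def, Complex.mul_conj, Complex.ofReal_re]
  refine mul_pos (by norm_num) (Finset.sum_pos' (fun j _ => Finset.sum_nonneg fun k _ =>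
    summand_nonneg j k) ⟨j, Finset.mem_univ j, Finset.sum_pos' (fun k _ => summand_nonneg j k)
      ⟨k, Finset.mem_univ k, mul_pos (weights_re_pos ha hb hc j k) (Complex.normSq_pos.2 hjk)⟩⟩)

theorem metric_one : metric U 1 1 1 = B := by
  refine LinearMap.ext₂ fun X Y => congrArg (B · Y) (inFrame_injective U (Matrix.ext fun j k => ?_))
  rw [inFrame_Lam_apply]
  fin_cases j <;> fin_cases k <;> simp [weights]

theorem B_pos {X : su3} (hX : X ≠ 0) : 0 < B X X :=
  metric_one 1 ▸ metric_pos 1 one_pos one_pos one_pos hX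

theorem inFrame_Ad_apply_of_isDiag {V : SU3} (hV : ((U : Mat3)ᴴ * (V : Mat3) * (U : Mat3)).IsDiag) :
    ∃ d : Fin 3 → ℂ, (∀ j, d j * star (d j) = 1) ∧
      ∀ X j k, inFrame U (Ad V X) j k = d j * inFrame U X j k * star (d k) := by
  obtain ⟨d, hd⟩ : ∃ d, Matrix.diagonal d = (U : Mat3)ᴴ * (V : Mat3) * (U : Mat3) :=
    ⟨_, hV.diagonal_diag⟩
  have hd_star : Matrix.diagonal (star d) = (U : Mat3)ᴴ * (V : Mat3)ᴴ * (U : Mat3) := by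
    rw [← Matrix.diagonal_conjTranspose, hd]
    simp only [Matrix.conjTranspose_mul, Matrix.conjTranspose_conjTranspose, mul_assoc]
  refine ⟨d, fun j => ?_, fun X j k => ?_⟩
  · have h : Matrix.diagonal d * Matrix.diagonal (star d) = 1 := by
      rw [hd, hd_star, conj_mul_conj, mul_conjTranspose_self, mul_one, conjTranspose_mul_self]
    rw [Matrix.diagonal_mul_diagonal] at h
    simpa using congrFun₂ h j j
  · have h : inFrame U (Ad V X)
        = Matrix.diagonal d * inFrame U X * Matrix.diagonal (star d) := by
      rw [hd, hd_star, inFrame_apply U X, conj_mul_conj, conj_mul_conj]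
      rfl
    rw [h, Matrix.mul_diagonal, Matrix.diagonal_mul, Pi.star_apply]

theorem isTorusInvariant_metric (a b c : ℝ) : IsTorusInvariant U (metric U a b c) := by
  intro V hV X Y
  obtain ⟨d, hd, hAd⟩ := inFrame_Ad_apply_of_isDiag U hV
  have mul_star (j k : Fin 3) : inFrame U (Ad V X) j k * star (inFrame U (Ad V Y) j k)
      = inFrame U X j k * star (inFrame U Y j k) := by
    rw [hAd, hAd, star_mul', star_mul', star_star]
    linear_combination (inFrame U X j k * star (inFrame U Y j k)) * (d k * star (d k)) * hd j
      + (inFrame U X j k * star (inFrame U Y j k)) * hd k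
  simp only [metric_eq_sum_inFrame, mul_star]

end Frame

section RootElement

variable (U : SU3) {j k : Fin 3}

/-- The element of `𝔰𝔲(3)` whose matrix in the frame `U` is `z E_{jk} - z̄ E_{kj}`. For fixed
`j < k` these elements form the real root space of the positive root `(j, k)`. -/
def rootElement (hjk : j ≠ k) (z : ℂ) : su3 :=
  Ad U ⟨Matrix.single j k z - Matrix.single k j (star z), by
    simp [Matrix.conjTranspose_single], by
    rw [Matrix.trace_sub, Matrix.trace_single_eq_of_ne _ _ _ hjk,
      Matrix.trace_single_eq_of_ne _ _ _ hjk.symm, sub_zero]⟩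

theorem inFrame_rootElement (hjk : j ≠ k) (z : ℂ) :
    inFrame U (rootElement U hjk z) = Matrix.single j k z - Matrix.single k j (star z) :=
  inFrame_Ad U _

theorem inFrame_rootElement_apply (hjk : j ≠ k) (z : ℂ) :
    inFrame U (rootElement U hjk z) j k = z := by
  simp [inFrame_rootElement, hjk.symm]

theorem rootElement_neg (hjk : j ≠ k) (z : ℂ) :
    rootElement U hjk (-z) = -rootElement U hjk z := by
  refine inFrame_injective U ?_
  rw [map_neg, inFrame_rootElement, inFrame_rootElement, star_neg, ← Matrix.single_neg,
    ← Matrix.single_neg]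
  abel

theorem B_rootElement (X : su3) (hjk : j ≠ k) (z : ℂ) :
    B X (rootElement U hjk z) = 12 * (inFrame U X j k * star z).re := by
  rw [B_eq_trace_inFrame U, inFrame_rootElement, mul_sub, Matrix.trace_sub,
    Matrix.trace_mul_single, Matrix.trace_mul_single, inFrame_swap U X j k]
  simp only [MulOpposite.smul_eq_mul_unop, MulOpposite.unop_op, RCLike.star_def, mul_neg, neg_mul,
    Complex.sub_re, Complex.neg_re, Complex.mul_re, Complex.conj_re, Complex.conj_im]
  ring

theorem rootElement_one_add_I_smul_rootElement_I (hjk : j ≠ k) :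
    (((1 / 2 : ℝ) • rootElement U hjk 1 : su3) : Mat3)
        + Complex.I • (((-1 / 2 : ℝ) • rootElement U hjk Complex.I : su3) : Mat3)
      = (U : Mat3) * Matrix.single j k 1 * (U : Mat3)ᴴ := by
  have h : (1 / 2 : ℝ) • (Matrix.single j k 1 - Matrix.single k j (star 1) : Mat3)
      + Complex.I • (-1 / 2 : ℝ) • (Matrix.single j k Complex.I
        - Matrix.single k j (star Complex.I) : Mat3) = Matrix.single j k 1 := by
    ext a b
    simp only [Matrix.add_apply, Matrix.smul_apply, Matrix.sub_apply, Matrix.single_apply]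
    split_ifs <;> apply Complex.ext <;> norm_num
  rw [← h]
  simp only [mul_add, add_mul, mul_smul_comm, smul_mul_assoc]
  rfl

end RootElement

section Adapted

variable {J : su3 →ₗ[ℝ] su3} {U : SU3} {j k : Fin 3}

theorem trace_conj_single_mul (X : su3) (j k : Fin 3) :
    ((X : Mat3) * ((U : Mat3) * Matrix.single j k 1 * (U : Mat3)ᴴ)).trace = inFrame U X k j := by
  rw [← mul_assoc, Matrix.trace_mul_comm, ← mul_assoc, ← mul_assoc, ← inFrame_apply,
    Matrix.trace_mul_single, MulOpposite.op_one, one_smul]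

theorem map_rootElement_of_inFrame_map (hJ : ∀ X, J (J X) = -X) (hB : IsHermitianMetric J B)
    (hJU : ∀ X, inFrame U (J X) j k = Complex.I * inFrame U X j k) (hjk : j ≠ k) (z : ℂ) :
    J (rootElement U hjk z) = rootElement U hjk (Complex.I * z) := by
  refine eq_of_forall_apply_eq hB.pos fun Z => ?_
  rw [hB.apply_map_left hJ, B_comm, B_comm _ Z, B_rootElement, B_rootElement, hJU, star_mul',
    Complex.star_def, Complex.conj_I, ← mul_neg, ← Complex.neg_re]
  congr 2
  ring

theorem isAdapted_iff (hJ : ∀ X, J (J X) = -X) (hB : IsHermitianMetric J B) :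
    IsAdapted J U ↔
      ∀ j k, j < k → ∀ X, inFrame U (J X) j k = Complex.I * inFrame U X j k := by
  refine forall₃_congr fun j k hjk => ⟨?_, fun h => ?_⟩
  · rintro ⟨X, Y, hXY, hJXY⟩ Z
    have trace_map_mul (W : su3) :
        ((J Z : Mat3) * (W : Mat3)).trace = -((Z : Mat3) * (J W : Mat3)).trace := by
      rw [trace_mul_eq_neg_B_div_six, trace_mul_eq_neg_B_div_six, hB.apply_map_left hJ]
      push_cast
      ring
    have h : inFrame U (J Z) k j = -(Complex.I * inFrame U Z k j) := by
      rw [← trace_conj_single_mul, ← trace_conj_single_mul, ← hXY, mul_add, mul_smul_comm,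
        Matrix.trace_add, Matrix.trace_smul, trace_map_mul, trace_map_mul, smul_neg, ← neg_add,
        ← Matrix.trace_smul, ← mul_smul_comm, ← Matrix.trace_add, ← mul_add, hJXY, mul_smul_comm,
        Matrix.trace_smul, smul_eq_mul]
    rw [inFrame_swap U _ k j, h, inFrame_swap U Z k j]
    simp
  · refine ⟨_, _, rootElement_one_add_I_smul_rootElement_I U hjk.ne, ?_⟩
    rw [map_smul, map_smul, map_rootElement_of_inFrame_map hJ hB h,
      map_rootElement_of_inFrame_map hJ hB h, mul_one,
      Complex.I_mul_I, rootElement_neg]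
    simp only [Submodule.coe_smul, Submodule.coe_neg, smul_add, smul_smul, Complex.I_mul_I,
      neg_div, neg_smul, smul_neg, neg_neg, one_smul]
    exact add_comm ..

theorem exists_isAdapted (hJ : IsComplexStructure J) (hB : IsHermitianMetric J B) :
    ∃ U : SU3, IsAdapted J U := by
  obtain ⟨U, hU, hq⟩ := exists_specialUnitary_blockTriangular (holomorphicSubalgebra hJ)
    fun _ hM _ hN => trace_mul_eq_zero_of_mem_holomorphicSubalgebra hJ hB hM hN
  refine ⟨⟨U, hU⟩, (isAdapted_iff hJ.map_map hB).2 fun j k hjk X => ?_⟩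
  have h : inFrame ⟨U, hU⟩ X k j - Complex.I * inFrame ⟨U, hU⟩ (J X) k j = 0 := by
    rw [← hq _ ⟨X, rfl⟩ hjk, mul_sub, sub_mul, mul_smul_comm, smul_mul_assoc]
    rfl
  rw [inFrame_swap _ _ k j, inFrame_swap _ X k j, eq_of_sub_eq_zero h]
  simp [← mul_assoc]

end Adapted

variable {J : su3 →ₗ[ℝ] su3} {U : SU3} {a b c : ℝ}

theorem isHermitianMetric_B (hB : ∀ X Y, B (J X) (J Y) = B X Y) : IsHermitianMetric J B :=
  ⟨B_comm, fun _ => B_pos, hB⟩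

theorem isDiag_inFrame_iff {X : su3} :
    (inFrame U X).IsDiag ↔ ∀ j k, j < k → inFrame U X j k = 0 := by
  refine ⟨fun h j k hjk => h hjk.ne, fun h j k hjk => ?_⟩
  rcases hjk.lt_or_gt with hjk | hjk
  · exact h j k hjk
  · rw [inFrame_swap, h k j hjk, star_zero, neg_zero]

section Hermitian

variable (hJ : ∀ X, J (J X) = -X) (hB : IsHermitianMetric J B) (hU : IsAdapted J U)
include hJ hB hU

theorem IsAdapted.isDiag_map {X : su3} (hX : (inFrame U X).IsDiag) :
    (inFrame U (J X)).IsDiag :=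
  isDiag_inFrame_iff.2 fun j k hjk => by
    rw [(isAdapted_iff hJ hB).1 hU j k hjk, hX hjk.ne, mul_zero]

theorem IsAdapted.inFrame_map_mul_star {j k : Fin 3} (hjk : j ≠ k) (X Y : su3) :
    (inFrame U (J X) j k * star (inFrame U (J Y) j k))
      = (inFrame U X j k * star (inFrame U Y j k)) := by
  have of_lt {j k : Fin 3} (hjk : j < k) (X Y : su3) :
      (inFrame U (J X) j k * star (inFrame U (J Y) j k))
        = (inFrame U X j k * star (inFrame U Y j k)) := by
    rw [(isAdapted_iff hJ hB).1 hU j k hjk, (isAdapted_iff hJ hB).1 hU j k hjk, star_mul',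
      mul_mul_mul_comm, Complex.star_def, Complex.conj_I, mul_neg, Complex.I_mul_I, neg_neg,
      one_mul]
  rcases hjk.lt_or_gt with hjk | hjk
  · exact of_lt hjk X Y
  · simpa only [inFrame_swap U _ k j, star_neg, star_star, neg_mul_neg, mul_comm]
      using of_lt hjk Y X

theorem IsAdapted.isHermitianMetric_metric (ha : 0 < a) (hb : 0 < b) (hc : 0 < c) :
    IsHermitianMetric J (metric U a b c) where
  symm := metric_symm U a b c
  pos _ := metric_pos U ha hb hc
  map_map X Y := by
    have metric_eq_B_add (X Y : su3) : metric U a b c X Y = B X Y + 6 * ∑ j, ∑ k,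
        ((weights a b c j k).re - 1) * (inFrame U X j k * star (inFrame U Y j k)).re := by
      simp only [metric_eq_sum_inFrame, B_eq_sum_inFrame U, sub_mul, one_mul,
        Finset.sum_sub_distrib]
      ring
    rw [metric_eq_B_add, metric_eq_B_add, hB.map_map]
    congr! 4 with j _ k
    obtain rfl | hjk := eq_or_ne j k
    · rw [weights_diag, Complex.one_re, sub_self, zero_mul, zero_mul]
    · rw [hU.inFrame_map_mul_star hJ hB hjk]

end Hermitian

section OrthogonalBasis

variable (U)

/-- The element of the Cartan subalgebra of the frame `U` given by the simple root `(0, 1)`: `i`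
times its coroot. -/
def cartanElement : su3 :=
  Ad U ⟨Matrix.diagonal ![Complex.I, -Complex.I, 0], by
    simp only [Matrix.diagonal_conjTranspose, Matrix.diagonal_neg]
    congr 1
    ext j
    fin_cases j <;> simp, by
    simp [Matrix.trace_diagonal, Fin.sum_univ_three]⟩

theorem inFrame_cartanElement :
    inFrame U (cartanElement U) = Matrix.diagonal ![Complex.I, -Complex.I, 0] :=
  inFrame_Ad U _

theorem isDiag_inFrame_cartanElement : (inFrame U (cartanElement U)).IsDiag :=
  inFrame_cartanElement U ▸ Matrix.isDiag_diagonal _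

theorem B_cartanElement (X : su3) :
    B X (cartanElement U) = 6 * ((inFrame U X 0 0).im - (inFrame U X 1 1).im) := by
  rw [B_eq_trace_inFrame U, inFrame_cartanElement, Matrix.trace_fin_three]
  simp only [Matrix.mul_diagonal, Matrix.cons_val, mul_neg, mul_zero, add_zero, Complex.add_re,
    Complex.neg_re, Complex.mul_re, Complex.I_re, Complex.I_im]
  ring

/-- One vector in each of the `J`-invariant planes spanned by the root spaces of the positive roots
and in the Cartan subalgebra, for `J` adapted to `U`. -/
def adaptedFrame : Fin 4 → su3 :=
  ![rootElement U (show (0 : Fin 3) ≠ 1 by decide) 1,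
    rootElement U (show (1 : Fin 3) ≠ 2 by decide) 1,
    rootElement U (show (0 : Fin 3) ≠ 2 by decide) 1, cartanElement U]

theorem B_adaptedFrame (X : su3) (i : Fin 4) :
    B X (adaptedFrame U i) = ![12 * (inFrame U X 0 1).re, 12 * (inFrame U X 1 2).re,
      12 * (inFrame U X 0 2).re, 6 * ((inFrame U X 0 0).im - (inFrame U X 1 1).im)] i := by
  fin_cases i <;> simp [adaptedFrame, B_rootElement, B_cartanElement]

theorem isOrthoᵢ_adaptedFrame : B.IsOrthoᵢ (adaptedFrame U) := by
  rw [LinearMap.isOrthoᵢ_def]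
  intro i j hij
  rw [B_adaptedFrame]
  fin_cases i <;> fin_cases j <;>
    first | exact absurd rfl hij |
      simp [adaptedFrame, inFrame_rootElement, inFrame_cartanElement]

theorem weights_symm (a b c : ℝ) (j k : Fin 3) : weights a b c k j = weights a b c j k := by
  fin_cases j <;> fin_cases k <;> rfl

theorem Lam_rootElement (a b c : ℝ) {j k : Fin 3} (hjk : j ≠ k) (z : ℂ) :
    Lam U a b c (rootElement U hjk z) = (weights a b c j k).re • rootElement U hjk z := by
  refine inFrame_injective U (Matrix.ext fun l m => ?_)
  rw [inFrame_Lam_apply, map_smul, inFrame_rootElement, Matrix.smul_apply, Complex.real_smul,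
    ← weights_eq_ofReal_re]
  simp only [Matrix.sub_apply, Matrix.single_apply]
  split_ifs with h h' h'
  · exact absurd (h.1.trans h'.1.symm) hjk
  · rw [h.1, h.2]
  · rw [← h'.1, ← h'.2, weights_symm]
  · simp

theorem Lam_adaptedFrame (a b c : ℝ) (i : Fin 4) :
    Lam U a b c (adaptedFrame U i) = (![a, b, c, 1] : Fin 4 → ℝ) i • adaptedFrame U i := by
  fin_cases i <;>
    simp [adaptedFrame, Lam_rootElement, weights,
      Lam_eq_self U a b c (isDiag_inFrame_cartanElement U)]

end OrthogonalBasis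

/-! ### The Ricci form on `SU(3)` -/

theorem B_eq_of_isDiag {X Y : su3} (hX : (inFrame U X).IsDiag)
    (hX_eq : (inFrame U X 0 0).im = (inFrame U X 1 1).im)
    (hY_eq : (inFrame U Y 0 0).im = (inFrame U Y 1 1).im) :
    B X Y = 36 * ((inFrame U X 0 0).im * (inFrame U Y 0 0).im) := by
  have inner_eq_ite (j k : Fin 3) : (inFrame U X j k * star (inFrame U Y j k)).re
      = if j = k then (inFrame U X j j).im * (inFrame U Y j j).im else 0 := by
    split_ifs with hjk
    · rw [← hjk, inFrame_diag_eq_im_mul_I, inFrame_diag_eq_im_mul_I U Y]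
      simp
    · rw [hX hjk, zero_mul, Complex.zero_re]
  simp only [B_eq_sum_inFrame U, inner_eq_ite, Finset.sum_ite_eq, Finset.mem_univ, if_true,
    Fin.sum_univ_three, inFrame_two_two_im, ← hX_eq, ← hY_eq]
  ring

theorem lie_eq_zero_of_isDiag {X Y : su3} (hX : (inFrame U X).IsDiag)
    (hY : (inFrame U Y).IsDiag) : ⁅X, Y⁆ = 0 := by
  refine inFrame_injective U ?_
  rw [inFrame_lie, ← hX.diagonal_diag, ← hY.diagonal_diag, (Matrix.commute_diagonal _ _).eq,
    sub_self, map_zero]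

theorem inFrame_lie_rootElement (U : SU3) {j k : Fin 3} (hjk : j ≠ k) :
    inFrame U ⁅rootElement U hjk 1, rootElement U hjk Complex.I⁆
      = Matrix.single j j (2 * Complex.I) - Matrix.single k k (2 * Complex.I) := by
  simp only [inFrame_lie, inFrame_rootElement, sub_mul, mul_sub, Matrix.single_mul_single_same,
    Matrix.single_mul_single_of_ne _ _ _ _ hjk, Matrix.single_mul_single_of_ne _ _ _ _ hjk.symm]
  simp only [star_one, Complex.star_def, Complex.conj_I, one_mul, mul_one, zero_sub, sub_zero,
    two_mul, Matrix.single_add, ← Matrix.single_neg]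
  abel

theorem isDiag_lie_rootElement (U : SU3) {j k : Fin 3} (hjk : j ≠ k) :
    (inFrame U ⁅rootElement U hjk 1, rootElement U hjk Complex.I⁆).IsDiag := by
  rw [inFrame_lie_rootElement, ← Matrix.diagonal_single, ← Matrix.diagonal_single]
  exact (Matrix.isDiag_diagonal _).sub (Matrix.isDiag_diagonal _)

theorem B_lie_rootElement (X : su3) {j k : Fin 3} (hjk : j ≠ k) :
    B ⁅rootElement U hjk 1, rootElement U hjk Complex.I⁆ X
      = 12 * ((inFrame U X j j).im - (inFrame U X k k).im) := by
  rw [B_comm, B_eq_trace_inFrame U, inFrame_lie_rootElement, mul_sub, Matrix.trace_sub,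
    Matrix.trace_mul_single, Matrix.trace_mul_single]
  simp only [MulOpposite.smul_eq_mul_unop, MulOpposite.unop_op, Complex.sub_re, Complex.mul_re,
    Complex.mul_im, Complex.re_ofNat, Complex.im_ofNat, Complex.I_re, Complex.I_im]
  ring

theorem B_adaptedFrame_self (U : SU3) (i : Fin 4) :
    B (adaptedFrame U i) (adaptedFrame U i) = 12 := by
  rw [B_adaptedFrame]
  fin_cases i <;> norm_num [adaptedFrame, inFrame_rootElement_apply, inFrame_cartanElement]

theorem metric_adaptedFrame (U : SU3) (a b c : ℝ) (X : su3) (i : Fin 4) :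
    metric U a b c X (adaptedFrame U i)
      = (![a, b, c, 1] : Fin 4 → ℝ) i * B X (adaptedFrame U i) := by
  rw [metric_symm, metric_apply, Lam_adaptedFrame, map_smul, LinearMap.smul_apply, B_comm,
    smul_eq_mul]

/-- The values at `X`, divided by `i`, of the positive roots of the entries `(0, 1)`, `(1, 2)` and
`(0, 2)` of the frame `U`, indexed as in `adaptedFrame`. The entry `0` belongs to the Cartan vector;
the roots are extended by zero from the diagonal elements to all of `su3`. -/
def rootValue (U : SU3) (X : su3) : Fin 4 → ℝ :=
  ![(inFrame U X 0 0).im - (inFrame U X 1 1).im, (inFrame U X 1 1).im - (inFrame U X 2 2).im,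
    (inFrame U X 0 0).im - (inFrame U X 2 2).im, 0]

theorem rootValue_lie_zero_one (U : SU3) :
    rootValue U ⁅rootElement U (show (0 : Fin 3) ≠ 1 by decide) 1,
      rootElement U (show (0 : Fin 3) ≠ 1 by decide) Complex.I⁆ = ![4, -2, 2, 0] := by
  simp only [rootValue, inFrame_lie_rootElement, Matrix.sub_apply, Matrix.single_apply,
    Fin.reduceEq, and_self, if_true, if_false, Complex.sub_im, Complex.mul_im, Complex.re_ofNat,
    Complex.im_ofNat, Complex.I_re, Complex.I_im, Complex.zero_im]
  norm_num

theorem rootValue_lie_one_two (U : SU3) :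
    rootValue U ⁅rootElement U (show (1 : Fin 3) ≠ 2 by decide) 1,
      rootElement U (show (1 : Fin 3) ≠ 2 by decide) Complex.I⁆ = ![-2, 4, 2, 0] := by
  simp only [rootValue, inFrame_lie_rootElement, Matrix.sub_apply, Matrix.single_apply,
    Fin.reduceEq, and_self, if_true, if_false, Complex.sub_im, Complex.mul_im, Complex.re_ofNat,
    Complex.im_ofNat, Complex.I_re, Complex.I_im, Complex.zero_im]
  norm_num

theorem metric_injective_left {a' b' c' : ℝ} (h : metric U a b c = metric U a' b' c') :
    a = a' := by
  have h₀ := congrArg (fun g => g (adaptedFrame U 0) (adaptedFrame U 0)) h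
  simpa [metric_adaptedFrame, B_adaptedFrame_self] using h₀

section Adapted

variable (hJ : ∀ X, J (J X) = -X) (hB : IsHermitianMetric J B) (hU : IsAdapted J U)
include hJ hB hU

theorem IsAdapted.map_rootElement {j k : Fin 3} (hjk : j < k) (z : ℂ) :
    J (rootElement U hjk.ne z) = rootElement U hjk.ne (Complex.I * z) :=
  map_rootElement_of_inFrame_map hJ hB ((isAdapted_iff hJ hB).1 hU j k hjk) hjk.ne z

theorem IsAdapted.B_map_adaptedFrame (i j : Fin 4) :
    B (J (adaptedFrame U i)) (adaptedFrame U j) = 0 := by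
  have h : (inFrame U (J (cartanElement U))).IsDiag :=
    hU.isDiag_map hJ hB (isDiag_inFrame_cartanElement U)
  by_cases hij : i = j
  · rw [hij, hB.symm, hB.apply_map_self hJ]
  rw [B_adaptedFrame]
  fin_cases i <;> fin_cases j <;>
    first | exact absurd rfl hij |
      simp [adaptedFrame, hU.map_rootElement hJ hB, inFrame_rootElement,
        h (show (0 : Fin 3) ≠ 1 by decide), h (show (0 : Fin 3) ≠ 2 by decide),
        h (show (1 : Fin 3) ≠ 2 by decide)]

theorem IsAdapted.eq_zero_of_B_adaptedFrame {X : su3} (hX : ∀ i, B X (adaptedFrame U i) = 0)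
    (hX_map : ∀ i, B X (J (adaptedFrame U i)) = 0) : X = 0 := by
  have hJX (i) : B (J X) (adaptedFrame U i) = 0 := by
    rw [hB.apply_map_left hJ, hX_map, neg_zero]
  obtain ⟨re_zero_one, re_one_two, re_zero_two, im_eq⟩ :
      (inFrame U X 0 1).re = 0 ∧ (inFrame U X 1 2).re = 0 ∧ (inFrame U X 0 2).re = 0
        ∧ (inFrame U X 0 0).im = (inFrame U X 1 1).im := by
    simpa [B_adaptedFrame, Fin.forall_fin_succ, sub_eq_zero] using hX
  obtain ⟨im_zero_one, im_one_two, im_zero_two, im_map_eq⟩ :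
      (inFrame U X 0 1).im = 0 ∧ (inFrame U X 1 2).im = 0 ∧ (inFrame U X 0 2).im = 0
        ∧ (inFrame U (J X) 0 0).im = (inFrame U (J X) 1 1).im := by
    simpa [B_adaptedFrame, Fin.forall_fin_succ, sub_eq_zero, (isAdapted_iff hJ hB).1 hU] using hJX
  have hX_diag : (inFrame U X).IsDiag := by
    refine isDiag_inFrame_iff.2 fun j k hjk => ?_
    fin_cases j <;> fin_cases k <;> simp_all [Complex.ext_iff]
  have im_mul_im : (inFrame U X 0 0).im * (inFrame U (J X) 0 0).im = 0 := by
    linarith [hB.apply_map_self hJ X, B_eq_of_isDiag hX_diag im_eq im_map_eq]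
  by_contra hX_ne
  have hXX := B_pos hX_ne
  have hJXX := hB.map_map X X ▸ hXX
  rw [B_eq_of_isDiag hX_diag im_eq im_eq] at hXX
  rw [B_eq_of_isDiag (hU.isDiag_map hJ hB hX_diag) im_map_eq im_map_eq] at hJXX
  rcases mul_eq_zero.1 im_mul_im with h | h
  · simp [h] at hXX
  · simp [h] at hJXX

theorem IsAdapted.isOrthoᵢ_B_sumElim :
    B.IsOrthoᵢ (Sum.elim (adaptedFrame U) (J ∘ adaptedFrame U)) :=
  hB.isOrthoᵢ_sumElim_map hJ (isOrthoᵢ_adaptedFrame U) (hU.B_map_adaptedFrame hJ hB)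

theorem IsAdapted.exists_basis_eq_sumElim :
    ∃ E : Module.Basis (Fin 4 ⊕ Fin 4) ℝ su3,
      ⇑E = Sum.elim (adaptedFrame U) (J ∘ adaptedFrame U) := by
  have B_self_ne_zero (i) : B (adaptedFrame U i) (adaptedFrame U i) ≠ 0 := by
    rw [B_adaptedFrame_self]
    norm_num
  refine exists_basis_eq_of_isOrthoᵢ (hU.isOrthoᵢ_B_sumElim hJ hB) ?_ fun X hX =>
    hU.eq_zero_of_B_adaptedFrame hJ hB (fun i => hX (.inl i)) fun i => hX (.inr i)
  rintro (i | i)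
  · exact B_self_ne_zero i
  · exact (hB.map_map _ _).trans_ne (B_self_ne_zero i)

theorem IsAdapted.isOrthoᵢ_metric_sumElim (ha : 0 < a) (hb : 0 < b) (hc : 0 < c) :
    (metric U a b c).IsOrthoᵢ (Sum.elim (adaptedFrame U) (J ∘ adaptedFrame U)) := by
  have hg := hU.isHermitianMetric_metric hJ hB ha hb hc
  refine hg.isOrthoᵢ_sumElim_map hJ (LinearMap.isOrthoᵢ_def.2 fun i j hij => ?_) fun i j => ?_
  · rw [metric_adaptedFrame, LinearMap.isOrthoᵢ_def.1 (isOrthoᵢ_adaptedFrame U) i j hij, mul_zero]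
  · rw [metric_adaptedFrame, hU.B_map_adaptedFrame hJ hB, mul_zero]

theorem IsAdapted.lie_cartanElement : ⁅cartanElement U, J (cartanElement U)⁆ = 0 :=
  lie_eq_zero_of_isDiag (isDiag_inFrame_cartanElement U)
    (hU.isDiag_map hJ hB (isDiag_inFrame_cartanElement U))

theorem IsAdapted.isDiag_lie_adaptedFrame (i : Fin 4) :
    (inFrame U ⁅adaptedFrame U i, J (adaptedFrame U i)⁆).IsDiag := by
  fin_cases i <;>
    simp [adaptedFrame, hU.map_rootElement hJ hB, isDiag_lie_rootElement,
      hU.lie_cartanElement hJ hB, Matrix.isDiag_zero]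

theorem IsAdapted.B_lie_adaptedFrame (i : Fin 4) (X : su3) :
    B ⁅adaptedFrame U i, J (adaptedFrame U i)⁆ X = 12 * rootValue U X i := by
  fin_cases i <;>
    simp [adaptedFrame, rootValue, hU.map_rootElement hJ hB, B_lie_rootElement,
      hU.lie_cartanElement hJ hB]

theorem IsAdapted.trace_mul_eq (ha : 0 < a) (hb : 0 < b) (hc : 0 < c)
    {Γ : su3 →ₗ[ℝ] Module.End ℝ su3}
    (hΓ : ∀ X Y Z, metric U a b c (Γ X Y) Z = bismutForm J (metric U a b c) X Y Z) (X : su3) :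
    LinearMap.trace ℝ su3 (J * Γ X) = 2 * ((a⁻¹ - 1) * rootValue U X 0
      + (b⁻¹ - 1) * rootValue U X 1 + (c⁻¹ - 1) * rootValue U X 2) := by
  obtain ⟨E, hE⟩ := hU.exists_basis_eq_sumElim hJ hB
  have summand_eq (i : Fin 4) :
      metric U a b c ⁅adaptedFrame U i, J (adaptedFrame U i)⁆ X
          / metric U a b c (adaptedFrame U i) (adaptedFrame U i)
        - B ⁅adaptedFrame U i, J (adaptedFrame U i)⁆ X / B (adaptedFrame U i) (adaptedFrame U i)
      = (((![a, b, c, 1] : Fin 4 → ℝ) i)⁻¹ - 1) * rootValue U X i := by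
    rw [metric_adaptedFrame, B_adaptedFrame_self, metric_apply,
      Lam_eq_self U a b c (hU.isDiag_lie_adaptedFrame hJ hB i), hU.B_lie_adaptedFrame hJ hB]
    ring
  rw [trace_mul_eq_two_mul_sum hJ (hU.isHermitianMetric_metric hJ hB ha hb hc) hB B_lie hΓ hE
    (hE ▸ hU.isOrthoᵢ_metric_sumElim hJ hB ha hb hc) (hE ▸ hU.isOrthoᵢ_B_sumElim hJ hB)]
  simp [summand_eq, Fin.sum_univ_four]

end Adapted

section CYT

variable (hJ : IsComplexStructure J) (hB : IsHermitianMetric J B) (hU : IsAdapted J U)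
include hJ hB hU

theorem IsAdapted.isCYT_metric_iff_forall_lie (ha : 0 < a) (hb : 0 < b) (hc : 0 < c) :
    IsCYT J (metric U a b c) ↔ ∀ X Y : su3, (a⁻¹ - 1) * rootValue U ⁅X, Y⁆ 0
      + (b⁻¹ - 1) * rootValue U ⁅X, Y⁆ 1 + (c⁻¹ - 1) * rootValue U ⁅X, Y⁆ 2 = 0 := by
  have hg := hU.isHermitianMetric_metric hJ.map_map hB ha hb hc
  obtain ⟨Γ, hΓ⟩ := exists_apply_eq_bismutForm hg.pos J
  rw [isCYT_iff_trace_eq_zero hJ.map_map hg (isBismutProduct_of_apply_eq hJ hg hΓ)]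
  simp only [hU.trace_mul_eq hJ.map_map hB ha hb hc hΓ, mul_eq_zero, two_ne_zero, false_or]

theorem IsAdapted.isCYT_metric_iff (ha : 0 < a) (hb : 0 < b) (hc : 0 < c) :
    IsCYT J (metric U a b c) ↔ a⁻¹ + c⁻¹ = 2 ∧ b⁻¹ + c⁻¹ = 2 := by
  rw [hU.isCYT_metric_iff_forall_lie hJ hB ha hb hc]
  refine ⟨fun h => ?_, fun ⟨hac, hbc⟩ X Y => ?_⟩
  · have zero_ne_one : (0 : Fin 3) ≠ 1 := by decide
    have one_ne_two : (1 : Fin 3) ≠ 2 := by decide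
    have h_zero_one := h (rootElement U zero_ne_one 1) (rootElement U zero_ne_one Complex.I)
    have h_one_two := h (rootElement U one_ne_two 1) (rootElement U one_ne_two Complex.I)
    simp only [rootValue_lie_zero_one, Matrix.cons_val] at h_zero_one
    simp only [rootValue_lie_one_two, Matrix.cons_val] at h_one_two
    constructor <;> linarith
  · rw [eq_sub_of_add_eq hac, eq_sub_of_add_eq hbc]
    simp only [rootValue, Matrix.cons_val]
    ring

theorem IsAdapted.bijOn_isCYT_metric :
    Set.BijOn (fun t : ℝ => metric U t⁻¹ t⁻¹ (2 - t)⁻¹) (Set.Ioo 0 2)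
      {g | IsCYT J g ∧ ∃ a b c : ℝ, 0 < a ∧ 0 < b ∧ 0 < c ∧ g = metric U a b c} := by
  refine ⟨?_, fun t _ t' _ h => inv_injective (metric_injective_left h), ?_⟩
  · rintro t ⟨ht, ht₂⟩
    have ht' : 0 < t⁻¹ := inv_pos.2 ht
    have ht₂' : 0 < (2 - t)⁻¹ := inv_pos.2 (sub_pos.2 ht₂)
    refine ⟨(hU.isCYT_metric_iff hJ hB ht' ht' ht₂').2 ?_, _, _, _, ht', ht', ht₂', rfl⟩
    simp only [inv_inv, add_sub_cancel, and_self]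
  · rintro _ ⟨hg, a, b, c, ha, hb, hc, rfl⟩
    obtain ⟨hac, hbc⟩ := (hU.isCYT_metric_iff hJ hB ha hb hc).1 hg
    have hab : a = b := inv_injective (add_right_cancel (hac.trans hbc.symm))
    refine ⟨a⁻¹, ⟨inv_pos.2 ha, ?_⟩, ?_⟩
    · linarith [inv_pos.2 hc]
    · simp only [inv_inv, sub_eq_of_eq_add' hac.symm, ← hab]

end CYT

end SU3Geometry

end

theorem proposition2 (J : SU3Geometry.su3 →ₗ[ℝ] SU3Geometry.su3)
    (hJ : SU3Geometry.IsInvariantComplexStructure J)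
    (hB : ∀ X Y, SU3Geometry.B (J X) (J Y) = SU3Geometry.B X Y) :
    (∃ U : SU3Geometry.SU3, SU3Geometry.IsAdapted J U) ∧
    ∀ U : SU3Geometry.SU3, SU3Geometry.IsAdapted J U →
      (∀ a b c : ℝ, 0 < a → 0 < b → 0 < c →
        SU3Geometry.IsInvariantHermitianMetric J (SU3Geometry.metric U a b c) ∧
        SU3Geometry.IsTorusInvariant U (SU3Geometry.metric U a b c) ∧
        (SU3Geometry.IsCYT J (SU3Geometry.metric U a b c) ↔
          a⁻¹ + c⁻¹ = 2 ∧ b⁻¹ + c⁻¹ = 2)) ∧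
      Set.BijOn (fun t : ℝ => SU3Geometry.metric U t⁻¹ t⁻¹ (2 - t)⁻¹) (Set.Ioo 0 2)
        {g | SU3Geometry.IsCYT J g ∧
          ∃ a b c : ℝ, 0 < a ∧ 0 < b ∧ 0 < c ∧ g = SU3Geometry.metric U a b c} := by
  have hJ' : IsComplexStructure J := hJ.isComplexStructure
  have hB' : IsHermitianMetric J SU3Geometry.B := SU3Geometry.isHermitianMetric_B hB
  refine ⟨SU3Geometry.exists_isAdapted hJ' hB', fun U hU =>
    ⟨fun a b c ha hb hc => ⟨?_, ?_, ?_⟩, ?_⟩⟩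
  · exact SU3Geometry.isInvariantHermitianMetric_iff.2
      (hU.isHermitianMetric_metric hJ'.map_map hB' ha hb hc)
  · exact SU3Geometry.isTorusInvariant_metric U a b c
  · exact hU.isCYT_metric_iff hJ' hB' ha hb hc
  · exact hU.bijOn_isCYT_metric hJ' hB'
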